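/- Let $n\ge 1$ and let $q\in\mathbb C^*$ with $q^2\neq 1$ and, if $n\ge 2$, also $q^4\ne 1$ (so that all $q$-numbers and Gaussian binomials in the definition below have non-zero denominators). Label the simple roots of type $A_{2n-1}$ along the Dynkin diagram as $\mu_{n-1},\dots,\mu_1,\beta,\nu_1,\dots,\nu_{n-1}$. Let $(a_{ij})$ be the Cartan matrix and $P$ the weight lattice, spanned by the fundamental weights $\lambda_i$, with $(\alpha_i|\lambda_j)=\delta_{ij}$ and $\alpha_i=\sum_j a_{ji}\lambda_j$. Let $U_q$ be the $\mathbb C$-algebra generated by $E_i,F_i$ ($1\le i\le 2n-1$) and $L_\zeta$ ($\zeta\in P$) with defining relations $L_0=1$, $L_\zeta L_\xi=L_{\zeta+\xi}$, $L_\zeta E_j=q^{(\alpha_j|\zeta)}E_jL_\zeta$, $L_\zeta F_j=q^{-(\alpha_j|\zeta)}F_jL_\zeta$, $E_iF_j-F_jE_i=\delta_{ij}\frac{L_{\alpha_i}-L_{-\alpha_i}}{q-q^{-1}}$, and the quantum Serre relations $E_iE_j=E_jE_i$, $F_iF_j=F_jF_i$ if $a_{ij}=0$, and $E_i^2E_j-(q+q^{-1})E_iE_jE_i+E_jE_i^2=0=F_i^2F_j-(q+q^{-1})F_iF_jF_i+F_jF_i^2$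 if $a_{ij}=-1$. For a simple root $\mu$ and an element $x$ of weight $\alpha$ put $(\mathrm{ad}\,E_\mu)(x)=E_\mu x-q^{-(\alpha|\mu)}xE_\mu$, and for $1\le i,j\le n$ let $$Z_{i,j}=(\mathrm{ad}\,E_{\mu_{i-1}})\cdots(\mathrm{ad}\,E_{\mu_1})(\mathrm{ad}\,E_{\nu_{j-1}})\cdots(\mathrm{ad}\,E_{\nu_1})(E_\beta),$$ an element of weight $\alpha_{i,j}=\mu_1+\cdots+\mu_{i-1}+\beta+\nu_1+\cdots+\nu_{j-1}$. For $\wp=(\zeta_1,\dots,\zeta_n,\xi_1,\dots,\xi_n)\in P^{2n}$ let $\tilde Z_{i,j}=Z_{i,j}L_{\zeta_i}L_{\xi_j}$, and let the modified algebra $M_q^\wp(n)$ be the (unital) subalgebra of $U_q$ generated by all $\tilde Z_{i,j}$, $1\le i,j\le n$. Theorem. For every such $n,q$ and every $\wp\in P^{2n}$: (1) $M_q^\wp(n)$ is an iterated Ore extension of $\mathbb C$ in the $n^2$ variables $\tilde Z_{i,j}$, adjoined in lexicographic order: if $M_k$ is the subalgebra generated by the first $k$ of the $\tilde Z_{i,j}$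 and $x$ is the next one, then $M_{k+1}$ is a free left $M_k$-module with basis $1,x,x^2,\dots$, and there are an automorphism $\sigma$ of $M_k$ and a $\sigma$-derivation $\delta$ of $M_k$ with $xa=\sigma(a)x+\delta(a)$ for all $a\in M_k$. (2) $M_q^\wp(n)$ is a domain. (3) $M_q^\wp(n)$ is the direct sum of the subspaces $M_d$ ($d\ge 0$) spanned by all products of $d$ of the generators $\tilde Z_{i,j}$, and its Hilbert series $\sum_d \dim(M_d)\,t^d$ equals that of the commutative polynomial ring in $n^2$ variables over $\mathbb C$. (4) The following are defining relations of $M_q^\wp(n)$ on the generators $\tilde Z_{i,j}$: \begin{align*} \tilde Z_{i,j}\tilde Z_{i,k}&=q^{(\alpha_{i,k}|\zeta_i+\xi_j)-(\alpha_{i,j}|\zeta_i+\xi_k)+1}\tilde Z_{i,k}\tilde Z_{i,j} && (j<k),\\ \tilde Z_{i,j}\tilde Z_{k,j}&=q^{(\alpha_{k,j}|\zeta_i+\xi_j)-(\alpha_{i,j}|\zeta_k+\xi_j)+1}\tilde Z_{k,j}\tilde Z_{i,j} && (i<k),\\ \tilde Z_{i,j}\tilde Z_{s,t}&=q^{(\alpha_{s,t}|\zeta_i+\xi_j)-(\alpha_{i,j}|\zeta_s+\xi_t)}\tilde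 Z_{s,t}\tilde Z_{i,j} && (i<s,\ t<j),\\ \tilde Z_{i,j}\tilde Z_{s,t}&=q^{(\alpha_{s,t}|\zeta_i+\xi_j)-(\alpha_{i,j}|\zeta_s+\xi_t)}\tilde Z_{s,t}\tilde Z_{i,j}+(q-q^{-1})\,q^{(\alpha_{s,t}|\zeta_i+\xi_j)-(\alpha_{s,j}|\zeta_i+\xi_t)}\tilde Z_{i,t}\tilde Z_{s,j} && (i<s,\ j<t). \end{align*} -/

import Mathlib

namespace QuantumMatrix

noncomputable section

/-! ### Ore extensions -/

/-- `S = R[x; σ, δ]` inside an ambient `K`-algebra `A`: `S` is generated over its subalgebra `R`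
by `x`, it is a free left `R`-module with basis `1, x, x ^ 2, …`, and
`x * a = σ a * x + δ a` for an automorphism `σ` of `R` and a `σ`-derivation `δ` of `R`. -/
structure IsOreExtension {K A : Type*} [Field K] [Ring A] [Algebra K A]
    (R S : Subalgebra K A) (x : A) : Prop where
  le : R ≤ S
  mem : x ∈ S
  skew : ∃ (σ : R ≃ₐ[K] R) (δ : R →ₗ[K] R),
    (∀ a b : R, δ (a * b) = σ a * δ b + δ a * b) ∧
    ∀ a : R, x * (a : A) = (σ a : A) * x + (δ a : A)
  free : ∀ s ∈ S, ∃! c : ℕ →₀ R, s = c.sum fun i a => (a : A) * x ^ i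

/-- `A` is an iterated Ore extension `K[x₀][x₁; σ₁, δ₁]⋯[x_{N-1}; σ_{N-1}, δ_{N-1}]` of the base
field in the variables `x₀, …, x_{N-1}`, adjoined in this order. -/
def IsIteratedOreExtension (K : Type*) {A : Type*} [Field K] [Ring A] [Algebra K A] {N : ℕ}
    (x : Fin N → A) : Prop :=
  ∃ R : Fin (N + 1) → Subalgebra K A,
    R 0 = ⊥ ∧ R (Fin.last N) = ⊤ ∧ ∀ k : Fin N, IsOreExtension (R k.castSucc) (R k.succ) (x k)

/-! ### Hilbert series -/

/-- The Hilbert series `∑ d, (dim V d) t ^ d` of a sequence of subspaces. -/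
def hilbertSeries {K A : Type*} [Semiring K] [AddCommMonoid A] [Module K A]
    (V : ℕ → Submodule K A) : PowerSeries ℕ :=
  PowerSeries.mk fun d => Module.finrank K (V d)

/-! ### The quantized enveloping algebra of type `A` -/

/-- Elements of the root lattice of type `A_r`, in the basis of the simple roots. -/
abbrev RootLattice (r : ℕ) := Fin r → ℤ

/-- Elements of the weight lattice of type `A_r`, in the basis of the fundamental weights. -/
abbrev WeightLattice (r : ℕ) := Fin r → ℤ

/-- The simple root `α_k`. -/
def simpleRoot {r : ℕ} (k : Fin r) : RootLattice r := Pi.single k 1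

/-- The inclusion of the root lattice into the weight lattice, `α_k = ∑ j, a_{jk} λ_j`. -/
def toWeight {r : ℕ} (γ : RootLattice r) : WeightLattice r :=
  fun j => ∑ k, CartanMatrix.A r j k * γ k

/-- The pairing `(γ | ζ)` of a root lattice element with a weight,
determined by `(α_i | λ_j) = δ_{ij}`. -/
def pairing {r : ℕ} (γ : RootLattice r) (ζ : WeightLattice r) : ℤ := ∑ k, γ k * ζ k

/-- Generators `E_i`, `F_i` and `L_ζ` (`ζ` in the weight lattice). -/
inductive Gen (r : ℕ) : Type
  | E (i : Fin r)
  | F (i : Fin r)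
  | L (ζ : WeightLattice r)

/-- The defining relations of the quantized enveloping algebra of type `A_r` (all `d_i = 1`).
The first two say that the `L_ζ` are the monomials in the commuting invertible
elements `L_i = L_{λ_i}`. -/
inductive UqRel (r : ℕ) (q : ℂ) : FreeAlgebra ℂ (Gen r) → FreeAlgebra ℂ (Gen r) → Prop
  | L_zero : UqRel r q (FreeAlgebra.ι ℂ (Gen.L 0)) 1
  | L_add (ζ ξ : WeightLattice r) :
      UqRel r q (FreeAlgebra.ι ℂ (Gen.L ζ) * FreeAlgebra.ι ℂ (Gen.L ξ))
        (FreeAlgebra.ι ℂ (Gen.L (ζ + ξ)))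
  | L_E (ζ : WeightLattice r) (i : Fin r) :
      UqRel r q (FreeAlgebra.ι ℂ (Gen.L ζ) * FreeAlgebra.ι ℂ (Gen.E i))
        (q ^ pairing (simpleRoot i) ζ •
          (FreeAlgebra.ι ℂ (Gen.E i) * FreeAlgebra.ι ℂ (Gen.L ζ)))
  | L_F (ζ : WeightLattice r) (i : Fin r) :
      UqRel r q (FreeAlgebra.ι ℂ (Gen.L ζ) * FreeAlgebra.ι ℂ (Gen.F i))
        (q ^ (-pairing (simpleRoot i) ζ) •
          (FreeAlgebra.ι ℂ (Gen.F i) * FreeAlgebra.ι ℂ (Gen.L ζ)))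
  | E_F_self (i : Fin r) :
      UqRel r q
        (FreeAlgebra.ι ℂ (Gen.E i) * FreeAlgebra.ι ℂ (Gen.F i) -
          FreeAlgebra.ι ℂ (Gen.F i) * FreeAlgebra.ι ℂ (Gen.E i))
        ((q - q⁻¹)⁻¹ • (FreeAlgebra.ι ℂ (Gen.L (toWeight (simpleRoot i))) -
          FreeAlgebra.ι ℂ (Gen.L (-toWeight (simpleRoot i)))))
  | E_F_ne (i j : Fin r) (h : i ≠ j) :
      UqRel r q (FreeAlgebra.ι ℂ (Gen.E i) * FreeAlgebra.ι ℂ (Gen.F j))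
        (FreeAlgebra.ι ℂ (Gen.F j) * FreeAlgebra.ι ℂ (Gen.E i))
  | E_comm (i j : Fin r) (h : CartanMatrix.A r i j = 0) :
      UqRel r q (FreeAlgebra.ι ℂ (Gen.E i) * FreeAlgebra.ι ℂ (Gen.E j))
        (FreeAlgebra.ι ℂ (Gen.E j) * FreeAlgebra.ι ℂ (Gen.E i))
  | F_comm (i j : Fin r) (h : CartanMatrix.A r i j = 0) :
      UqRel r q (FreeAlgebra.ι ℂ (Gen.F i) * FreeAlgebra.ι ℂ (Gen.F j))
        (FreeAlgebra.ι ℂ (Gen.F j) * FreeAlgebra.ι ℂ (Gen.F i))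
  | E_serre (i j : Fin r) (h : CartanMatrix.A r i j = -1) :
      UqRel r q
        (FreeAlgebra.ι ℂ (Gen.E i) ^ 2 * FreeAlgebra.ι ℂ (Gen.E j) -
          (q + q⁻¹) • (FreeAlgebra.ι ℂ (Gen.E i) * FreeAlgebra.ι ℂ (Gen.E j) *
            FreeAlgebra.ι ℂ (Gen.E i)) +
          FreeAlgebra.ι ℂ (Gen.E j) * FreeAlgebra.ι ℂ (Gen.E i) ^ 2) 0
  | F_serre (i j : Fin r) (h : CartanMatrix.A r i j = -1) :
      UqRel r q
        (FreeAlgebra.ι ℂ (Gen.F i) ^ 2 * FreeAlgebra.ι ℂ (Gen.F j) -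
          (q + q⁻¹) • (FreeAlgebra.ι ℂ (Gen.F i) * FreeAlgebra.ι ℂ (Gen.F j) *
            FreeAlgebra.ι ℂ (Gen.F i)) +
          FreeAlgebra.ι ℂ (Gen.F j) * FreeAlgebra.ι ℂ (Gen.F i) ^ 2) 0

/-- The quantized enveloping algebra `U_q(sl_{r+1})`, with torus part the group algebra of the
weight lattice. -/
abbrev Uq (r : ℕ) (q : ℂ) : Type := RingQuot (UqRel r q)

/-- The generator `E_i` of the quantized enveloping algebra. -/
def E {r : ℕ} (q : ℂ) (i : Fin r) : Uq r q :=
  RingQuot.mkAlgHom ℂ (UqRel r q) (FreeAlgebra.ι ℂ (Gen.E i))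

/-- The element `L_ζ` of the quantized enveloping algebra. -/
def L {r : ℕ} (q : ℂ) (ζ : WeightLattice r) : Uq r q :=
  RingQuot.mkAlgHom ℂ (UqRel r q) (FreeAlgebra.ι ℂ (Gen.L ζ))

/-- For `x` of weight `γ`, the `q`-commutator
`(ad E_k)(x) = E_k x - q ^ (-⟨γ, α_k⟩) x E_k`. -/
def adE {r : ℕ} (q : ℂ) (k : Fin r) (γ : RootLattice r) (x : Uq r q) : Uq r q :=
  E q k * x - q ^ (-pairing γ (toWeight (simpleRoot k))) • (x * E q k)

/-! ### The elements `Z_{i,j}`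

The Dynkin diagram of type `A_{2n-1}` is
`μ_{n-1} - ⋯ - μ_1 - β - ν_1 - ⋯ - ν_{n-1}`; its nodes are numbered `0, …, 2n-2` from the left.
Rows and columns `i, j` are numbered `0, …, n-1`. -/

/-- The position of the noncompact simple root `β`. -/
def betaNode (n : ℕ) (h : 0 < n) : Fin (2 * n - 1) := ⟨n - 1, by omega⟩

/-- The position of the compact simple root `μ_k`, for `k = 1, …, n-1`. -/
def muNode (n k : ℕ) (h : k < n) : Fin (2 * n - 1) := ⟨n - 1 - k, by omega⟩

/-- The position of the compact simple root `ν_k`, for `k = 1, …, n-1`. -/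
def nuNode (n k : ℕ) (h : k < n) : Fin (2 * n - 1) := ⟨n - 1 + k, by omega⟩

/-- The root `(μ_1 + ⋯ + μ_i) + β + (ν_1 + ⋯ + ν_j)` of `Z_{i,j}` (numbered from `0`). -/
def rootNat (n : ℕ) : (i j : ℕ) → i < n → j < n → RootLattice (2 * n - 1)
  | 0, 0, hi, _ => simpleRoot (betaNode n hi)
  | 0, j + 1, hi, hj =>
      rootNat n 0 j hi (Nat.lt_of_succ_lt hj) + simpleRoot (nuNode n (j + 1) hj)
  | i + 1, j, hi, hj =>
      simpleRoot (muNode n (i + 1) hi) + rootNat n i j (Nat.lt_of_succ_lt hi) hj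

/-- `Z_{i,j} = (ad E_{μ_i}) ⋯ (ad E_{μ_1}) (ad E_{ν_j}) ⋯ (ad E_{ν_1}) (E_β)`
(numbered from `0`). -/
def ZNat (n : ℕ) (q : ℂ) : (i j : ℕ) → i < n → j < n → Uq (2 * n - 1) q
  | 0, 0, hi, _ => E q (betaNode n hi)
  | 0, j + 1, hi, hj =>
      adE q (nuNode n (j + 1) hj) (rootNat n 0 j hi (Nat.lt_of_succ_lt hj))
        (ZNat n q 0 j hi (Nat.lt_of_succ_lt hj))
  | i + 1, j, hi, hj =>
      adE q (muNode n (i + 1) hi) (rootNat n i j (Nat.lt_of_succ_lt hi) hj)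
        (ZNat n q i j (Nat.lt_of_succ_lt hi) hj)

/-- The root `α_{i,j}` of `Z_{i,j}`. -/
def root {n : ℕ} (i j : Fin n) : RootLattice (2 * n - 1) := rootNat n i j i.isLt j.isLt

/-- The generator `Z_{i,j}` of the standard quantized matrix algebra inside `U_q(sl_{2n})`. -/
def Z {n : ℕ} (q : ℂ) (i j : Fin n) : Uq (2 * n - 1) q := ZNat n q i j i.isLt j.isLt

/-! ### Modified algebras -/

variable {n : ℕ}

/-- `Z̃_{i,j} = Z_{i,j} L_{ζ_i} L_{ξ_j}`. -/
def Zt (q : ℂ) (ζ ξ : Fin n → WeightLattice (2 * n - 1)) (i j : Fin n) : Uq (2 * n - 1) q :=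
  Z q i j * L q (ζ i) * L q (ξ j)

/-- The modified algebra: the subalgebra of `U_q(sl_{2n})` generated by all `Z̃_{i,j}`. -/
def modifiedAlgebra (q : ℂ) (ζ ξ : Fin n → WeightLattice (2 * n - 1)) :
    Subalgebra ℂ (Uq (2 * n - 1) q) :=
  Algebra.adjoin ℂ (Set.range fun p : Fin n × Fin n => Zt q ζ ξ p.1 p.2)

/-- `Z̃_{i,j}` as an element of the modified algebra. -/
def genM (q : ℂ) (ζ ξ : Fin n → WeightLattice (2 * n - 1)) (p : Fin n × Fin n) :
    modifiedAlgebra q ζ ξ :=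
  ⟨Zt q ζ ξ p.1 p.2, Algebra.subset_adjoin ⟨p, rfl⟩⟩

/-- The degree `d` part of the modified algebra: the span of all products of `d` generators
`Z̃_{i,j}`. -/
def gradedPart (q : ℂ) (ζ ξ : Fin n → WeightLattice (2 * n - 1)) (d : ℕ) :
    Submodule ℂ (modifiedAlgebra q ζ ξ) :=
  Submodule.span ℂ (Set.range (genM q ζ ξ)) ^ d

/-- The free generator `X_{i,j}`. -/
def X (i j : Fin n) : FreeAlgebra ℂ (Fin n × Fin n) := FreeAlgebra.ι ℂ (i, j)

/-- The quadratic relations between the generators of a modified algebra. -/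
inductive ModRel (q : ℂ) (ζ ξ : Fin n → WeightLattice (2 * n - 1)) :
    FreeAlgebra ℂ (Fin n × Fin n) → FreeAlgebra ℂ (Fin n × Fin n) → Prop
  | row (i j k : Fin n) (h : j < k) :
      ModRel q ζ ξ (X i j * X i k)
        (q ^ (pairing (root i k) (ζ i + ξ j) - pairing (root i j) (ζ i + ξ k) + 1) •
          (X i k * X i j))
  | col (i j k : Fin n) (h : i < k) :
      ModRel q ζ ξ (X i j * X k j)
        (q ^ (pairing (root k j) (ζ i + ξ j) - pairing (root i j) (ζ k + ξ j) + 1) •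
          (X k j * X i j))
  | anti (i j s t : Fin n) (h : i < s) (h' : t < j) :
      ModRel q ζ ξ (X i j * X s t)
        (q ^ (pairing (root s t) (ζ i + ξ j) - pairing (root i j) (ζ s + ξ t)) •
          (X s t * X i j))
  | diag (i j s t : Fin n) (h : i < s) (h' : j < t) :
      ModRel q ζ ξ (X i j * X s t)
        (q ^ (pairing (root s t) (ζ i + ξ j) - pairing (root i j) (ζ s + ξ t)) •
            (X s t * X i j) +
          ((q - q⁻¹) *
              q ^ (pairing (root s t) (ζ i + ξ j) - pairing (root s j) (ζ i + ξ t))) •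
            (X i t * X s j))

end

end QuantumMatrix

/-!
The straightening relations let one reorder any word in the generators `Z̃_{i,j}`, so everything
reduces to one fact: the ordered monomials in the `Z̃_{i,j}` are linearly independent.
Given this, `x M_k ⊆ M_k x + M_k` for the next variable `x`, which yields `σ` and `δ`; Ore
extensions of domains are domains; and since the relations are homogeneous quadratic, the
ordered monomials of degree `d` form a basis of the degree `d` part, both in the modified algebra
and in the algebra presented by the relations.

The quadratic relations for the `Z_{i,j}`, which are iterated `q`-commutators of the `E_i`, follow
from the quantum Serre relations by induction along the two arms of the Dynkin diagram. Passing from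
`Z_{i,j}` to `Z̃_{i,j}` only multiplies an ordered monomial by a power of `q` and by some `L_θ` on
the right.

For the linear independence, let `U_q` act on its positive part as on a Verma module: there each
`Z_{i,j}` acts by left multiplication and each `L_θ` fixes the lowest weight vector. The Feigin
homomorphism then sends the positive part to a quantum torus, each `E_i` going to a sum of torus
variables. The images of the `Z_{i,j}` have leading monomials with linearly independent exponents,
hence distinct ordered monomials have distinct leading monomials.
-/

namespace QuantumMatrix

/-! ### Ordered monomials -/

section OrderedMonomials

/-- The ordered monomial `x₀ ^ a₀ * ⋯ * x_{k-1} ^ a_{k-1}` in the first `k` terms of a sequence of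
variables. -/
def orderedMonomial {M : Type*} [Monoid M] (x : ℕ → M) : (k : ℕ) → (Fin k → ℕ) → M
  | 0, _ => 1
  | k + 1, a => orderedMonomial x k (Fin.init a) * x k ^ a (Fin.last k)

section Monoid

variable {M M' : Type*} [Monoid M] [Monoid M'] (x : ℕ → M) (k : ℕ)

theorem orderedMonomial_snoc (a : Fin k → ℕ) (i : ℕ) :
    orderedMonomial x (k + 1) (Fin.snoc (α := fun _ => ℕ) a i) =
      orderedMonomial x k a * x k ^ i := by
  simp [orderedMonomial]

theorem orderedMonomial_zero : orderedMonomial x k 0 = 1 := by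
  induction k with
  | zero => rfl
  | succ k ih =>
    rw [orderedMonomial, show Fin.init (0 : Fin (k + 1) → ℕ) = 0 from rfl, ih, Pi.zero_apply,
      pow_zero, one_mul]

theorem map_orderedMonomial (f : M →* M') (a : Fin k → ℕ) :
    f (orderedMonomial x k a) = orderedMonomial (f ∘ x) k a := by
  induction k with
  | zero => exact map_one f
  | succ k ih => simp [orderedMonomial, ih]

variable {x k} in
theorem orderedMonomial_mem {S : Submonoid M} (h : ∀ l < k, x l ∈ S) (a : Fin k → ℕ) :
    orderedMonomial x k a ∈ S := by
  induction k with
  | zero => exact one_mem S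
  | succ k ih =>
    exact mul_mem (ih (fun l hl => h l (by omega)) _) (pow_mem (h k k.lt_succ_self) _)

end Monoid

variable {K A : Type*} [Field K] [Ring A] [Algebra K A] {x : ℕ → A} {k l N : ℕ}

theorem linearIndependent_orderedMonomial_mono (hk : k ≤ N)
    (h : LinearIndependent K (orderedMonomial x N)) :
    LinearIndependent K (orderedMonomial x k) := by
  induction N, hk using Nat.le_induction with
  | base => exact h
  | succ N _ ih =>
    refine ih ?_
    have := h.comp (fun a : Fin N → ℕ => Fin.snoc (α := fun _ => ℕ) a 0) fun a b hab => by
      simpa using congrArg Fin.init hab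
    simpa only [Function.comp_def, orderedMonomial_snoc, pow_zero, mul_one] using this

variable (K x k) in
/-- The span of the variables `x₀, …, x_{k-1}`. -/
def initialSpan : Submodule K A := Submodule.span K (x '' Set.Iio k)

variable (K x k) in
/-- The subalgebra generated by the variables `x₀, …, x_{k-1}`. -/
def initialAdjoin : Subalgebra K A := Algebra.adjoin K (x '' Set.Iio k)

theorem mem_initialSpan (h : l < k) : x l ∈ initialSpan K x k :=
  Submodule.subset_span ⟨l, h, rfl⟩

theorem mem_initialAdjoin (h : l < k) : x l ∈ initialAdjoin K x k :=
  Algebra.subset_adjoin ⟨l, h, rfl⟩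

theorem initialSpan_mono (h : k ≤ N) : initialSpan K x k ≤ initialSpan K x N :=
  Submodule.span_mono (Set.image_mono (Set.Iio_subset_Iio h))

theorem initialAdjoin_mono (h : k ≤ N) : initialAdjoin K x k ≤ initialAdjoin K x N :=
  Algebra.adjoin_mono (Set.image_mono (Set.Iio_subset_Iio h))

theorem initialSpan_succ (x : ℕ → A) (k : ℕ) :
    initialSpan K x (k + 1) = initialSpan K x k + Submodule.span K {x k} := by
  rw [initialSpan, initialSpan, Submodule.add_eq_sup, ← Submodule.span_union, ← Set.image_singleton,
    ← Set.image_union]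
  congr 2
  ext i
  simp [le_iff_lt_or_eq]

theorem toSubmodule_adjoin_eq_iSup_span_pow (s : Set A) :
    Subalgebra.toSubmodule (Algebra.adjoin K s) = ⨆ d : ℕ, Submodule.span K s ^ d := by
  apply le_antisymm
  · rw [Algebra.adjoin_eq_span, Submodule.span_le]
    intro y hy
    obtain ⟨d, hd⟩ : ∃ d : ℕ, y ∈ Submodule.span K s ^ d := by
      induction hy using Submonoid.closure_induction with
      | mem y hy => exact ⟨1, by simpa using Submodule.subset_span hy⟩
      | one => exact ⟨0, Submodule.one_le.1 (pow_zero _).ge⟩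
      | mul y z _ _ hy hz =>
        obtain ⟨⟨d, hd⟩, e, he⟩ := And.intro hy hz
        exact ⟨d + e, pow_add (Submodule.span K s) d e ▸ Submodule.mul_mem_mul hd he⟩
    exact Submodule.mem_iSup_of_mem d hd
  · refine iSup_le fun d => ?_
    induction d with
    | zero => exact Submodule.one_le.2 (one_mem (Algebra.adjoin K s))
    | succ d ih =>
      rw [pow_succ, ← (Subalgebra.isIdempotentElem_toSubmodule (Algebra.adjoin K s)).eq]
      exact mul_le_mul' ih (Algebra.span_le_adjoin K s)

theorem toSubmodule_initialAdjoin (x : ℕ → A) (k : ℕ) :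
    Subalgebra.toSubmodule (initialAdjoin K x k) = ⨆ d : ℕ, initialSpan K x k ^ d :=
  toSubmodule_adjoin_eq_iSup_span_pow _

theorem initialSpan_pow_le_initialAdjoin (d : ℕ) :
    initialSpan K x k ^ d ≤ Subalgebra.toSubmodule (initialAdjoin K x k) :=
  toSubmodule_initialAdjoin (K := K) x k ▸ le_iSup (fun d => initialSpan K x k ^ d) d

theorem orderedMonomial_mem_initialAdjoin (a : Fin k → ℕ) :
    orderedMonomial x k a ∈ initialAdjoin K x k :=
  orderedMonomial_mem (S := (initialAdjoin K x k).toSubmonoid) (fun _ => mem_initialAdjoin) a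

theorem orderedMonomial_mem_initialSpan_pow (a : Fin k → ℕ) :
    orderedMonomial x k a ∈ initialSpan K x k ^ ∑ i, a i := by
  induction k with
  | zero => exact Submodule.one_le.1 (by simp)
  | succ k ih =>
    rw [orderedMonomial, Fin.sum_univ_castSucc, pow_add]
    exact Submodule.mul_mem_mul (pow_le_pow_left' (initialSpan_mono k.le_succ) _ (ih (Fin.init a)))
      (Submodule.pow_mem_pow _ (mem_initialSpan k.lt_succ_self) _)

variable (K x k) in
/-- The span of the ordered monomials of degree `d` in `x₀, …, x_{k-1}`. -/
def orderedSpan (d : ℕ) : Submodule K A :=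
  Submodule.span K (orderedMonomial x k '' {a | ∑ i, a i = d})

theorem one_mem_orderedSpan : (1 : A) ∈ orderedSpan K x k 0 :=
  Submodule.subset_span ⟨0, by simp, orderedMonomial_zero x k⟩

theorem orderedSpan_mul_span_pow_le (i j : ℕ) :
    orderedSpan K x k i * Submodule.span K {x k} ^ j ≤ orderedSpan K x (k + 1) (i + j) := by
  rw [Submodule.span_pow, Set.singleton_pow, orderedSpan, Submodule.span_mul_span,
    Submodule.span_le]
  rintro _ ⟨_, ⟨a, rfl, rfl⟩, _, rfl, rfl⟩
  exact Submodule.subset_span ⟨Fin.snoc (α := fun _ => ℕ) a j,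
    by simp [Fin.sum_univ_castSucc], orderedMonomial_snoc x k a j⟩

theorem orderedSpan_le_initialSpan_pow (d : ℕ) : orderedSpan K x k d ≤ initialSpan K x k ^ d := by
  rw [orderedSpan, Submodule.span_le]
  rintro _ ⟨a, rfl, rfl⟩
  exact orderedMonomial_mem_initialSpan_pow a

end OrderedMonomials

/-! ### Straightening -/

section Straightening

theorem mul_pow_le_of_mul_le {α : Type*} [IdemSemiring α] {v s : α}
    (h : s * v ≤ v * s + v ^ 2) (d : ℕ) : s * v ^ d ≤ v ^ d * s + v ^ (d + 1) := by
  induction d with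
  | zero => simp
  | succ d ih =>
    calc s * v ^ (d + 1) = s * v ^ d * v := by rw [pow_succ, mul_assoc]
      _ ≤ (v ^ d * s + v ^ (d + 1)) * v := mul_le_mul_left ih v
      _ = v ^ d * (s * v) + v ^ (d + 2) := by rw [add_mul, mul_assoc, ← pow_succ]
      _ ≤ v ^ d * (v * s + v ^ 2) + v ^ (d + 2) := by gcongr
      _ = v ^ (d + 1) * s + v ^ (d + 2) := by
        rw [mul_add, ← mul_assoc, ← pow_succ, ← pow_add, add_assoc, add_idem]

theorem add_pow_le_sum_antidiagonal_of_mul_le {α : Type*} [IdemSemiring α] {v s : α}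
    (h : s * v ≤ v * s + v ^ 2) (d : ℕ) :
    (v + s) ^ d ≤ ∑ p ∈ Finset.HasAntidiagonal.antidiagonal d, v ^ p.1 * s ^ p.2 := by
  have le_sum (i j : ℕ) :
      v ^ i * s ^ j ≤ ∑ p ∈ Finset.HasAntidiagonal.antidiagonal (i + j), v ^ p.1 * s ^ p.2 :=
    Finset.single_le_sum_of_canonicallyOrdered (f := fun p : ℕ × ℕ => v ^ p.1 * s ^ p.2)
      (i := (i, j)) (Finset.HasAntidiagonal.mem_antidiagonal.2 rfl)
  induction d with
  | zero => simp
  | succ d ih =>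
    rw [pow_succ']
    refine (mul_le_mul_right ih _).trans ?_
    rw [Finset.mul_sum]
    refine Finset.sum_induction _ (· ≤ _) (fun _ _ => add_le) zero_le fun p hp => ?_
    obtain ⟨i, j⟩ := p
    obtain rfl : i + j = d := Finset.HasAntidiagonal.mem_antidiagonal.1 hp
    calc (v + s) * (v ^ i * s ^ j)
        = v ^ (i + 1) * s ^ j + s * v ^ i * s ^ j := by
          rw [add_mul, pow_succ']
          simp only [mul_assoc]
      _ ≤ v ^ (i + 1) * s ^ j + (v ^ i * s + v ^ (i + 1)) * s ^ j := by
        gcongr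
        exact mul_pow_le_of_mul_le h i
      _ = v ^ i * s ^ (j + 1) + v ^ (i + 1) * s ^ j := by
        rw [add_mul, mul_assoc, ← pow_succ', add_comm, add_assoc, add_idem]
      _ ≤ _ := add_le (le_sum i (j + 1)) ((le_sum (i + 1) j).trans_eq (by congr 2; omega))

variable {K A : Type*} [Field K] [Ring A] [Algebra K A] {x : ℕ → A} {k l N : ℕ}

variable (K) in
/-- The variables `x₀, …, x_{N-1}` can be put in increasing order by quadratic relations
`x_k x_l = c x_l x_k + ⋯` for `l < k`, the remaining terms involving only variables before
`x_k`. -/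
def Straightens (x : ℕ → A) (N : ℕ) : Prop :=
  ∀ k < N, ∀ l < k, ∃ c : K, c ≠ 0 ∧ x k * x l - c • (x l * x k) ∈ initialSpan K x k ^ 2

theorem Straightens.mono (h : Straightens K x N) (hk : k ≤ N) : Straightens K x k :=
  fun m hm l hl => h m (hm.trans_le hk) l hl

theorem Straightens.span_mul_initialSpan_le (h : Straightens K x (k + 1)) :
    Submodule.span K {x k} * initialSpan K x k ≤
      initialSpan K x k * Submodule.span K {x k} + initialSpan K x k ^ 2 := by
  refine (Submodule.span_mul_span K _ _).trans_le (Submodule.span_le.2 ?_)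
  rintro _ ⟨_, rfl, _, ⟨l, hl, rfl⟩, rfl⟩
  obtain ⟨c, -, hc⟩ := h k k.lt_succ_self l hl
  change x k * x l ∈ _
  rw [Submodule.add_eq_sup, ← sub_add_cancel (x k * x l) (c • (x l * x k)), add_comm]
  exact Submodule.add_mem_sup (Submodule.smul_mem _ _ (Submodule.mul_mem_mul
    (mem_initialSpan hl) (Submodule.mem_span_singleton_self _))) hc

theorem Straightens.initialSpan_pow_eq (h : Straightens K x k) (d : ℕ) :
    initialSpan K x k ^ d = orderedSpan K x k d := by
  refine le_antisymm ?_ (orderedSpan_le_initialSpan_pow d)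
  induction k generalizing d with
  | zero =>
    cases d with
    | zero => exact Submodule.one_le.2 one_mem_orderedSpan
    | succ d => simp [initialSpan, pow_succ]
  | succ k ih =>
    rw [initialSpan_succ]
    refine (add_pow_le_sum_antidiagonal_of_mul_le h.span_mul_initialSpan_le d).trans
      (Finset.sum_induction _ (· ≤ _) (fun _ _ => add_le) bot_le ?_)
    rintro ⟨i, j⟩ hij
    rw [← (Finset.HasAntidiagonal.mem_antidiagonal.1 hij : i + j = d)]
    exact (mul_le_mul_left (ih (h.mono k.le_succ) i) _).trans (orderedSpan_mul_span_pow_le i j)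

theorem Straightens.span_range_orderedMonomial (h : Straightens K x k) :
    Submodule.span K (Set.range (orderedMonomial x k)) =
      Subalgebra.toSubmodule (initialAdjoin K x k) := by
  apply le_antisymm
  · rw [Submodule.span_le]
    rintro _ ⟨a, rfl⟩
    exact orderedMonomial_mem_initialAdjoin a
  · rw [toSubmodule_initialAdjoin]
    refine iSup_le fun d => ?_
    rw [h.initialSpan_pow_eq]
    exact Submodule.span_mono (Set.image_subset_range _ _)

theorem Straightens.span_mul_initialAdjoin_le (h : Straightens K x (k + 1)) :
    Submodule.span K {x k} * Subalgebra.toSubmodule (initialAdjoin K x k) ≤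
      Subalgebra.toSubmodule (initialAdjoin K x k) * Submodule.span K {x k} +
        Subalgebra.toSubmodule (initialAdjoin K x k) := by
  rw [toSubmodule_initialAdjoin, Submodule.mul_iSup]
  refine iSup_le fun d => (mul_pow_le_of_mul_le h.span_mul_initialSpan_le d).trans ?_
  exact add_le_add (mul_le_mul_left (le_iSup (fun d => initialSpan K x k ^ d) d) _)
    (le_iSup (fun d => initialSpan K x k ^ d) (d + 1))

theorem Straightens.exists_mul_eq (h : Straightens K x (k + 1)) (a : initialAdjoin K x k) :
    ∃ r s : initialAdjoin K x k, x k * (a : A) = r * x k + s := by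
  obtain ⟨y, hy, s, hs, hys⟩ := Submodule.mem_sup.1 (h.span_mul_initialAdjoin_le
    (Submodule.mul_mem_mul (Submodule.mem_span_singleton_self (x k)) a.2))
  obtain ⟨r, hr, rfl⟩ := Submodule.mem_mul_span_singleton.1 hy
  exact ⟨⟨r, hr⟩, ⟨s, hs⟩, hys.symm⟩

variable (K) in
/-- The sequence `x₀, …, x_{N-1}` has the Poincaré–Birkhoff–Witt property: its products can be
straightened into combinations of ordered monomials, and the ordered monomials are linearly
independent. -/
structure IsPBWSequence (x : ℕ → A) (N : ℕ) : Prop where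
  straightens : Straightens K x N
  linearIndependent : LinearIndependent K (orderedMonomial x N)

namespace IsPBWSequence

theorem mono (h : IsPBWSequence K x N) (hk : k ≤ N) : IsPBWSequence K x k :=
  ⟨h.straightens.mono hk, linearIndependent_orderedMonomial_mono hk h.linearIndependent⟩

/-- The basis of the subalgebra generated by a PBW sequence that consists of the ordered
monomials. -/
noncomputable def basis (h : IsPBWSequence K x N) :
    Module.Basis (Fin N → ℕ) K (initialAdjoin K x N) :=
  (Module.Basis.span h.linearIndependent).map
    (LinearEquiv.ofEq _ _ h.straightens.span_range_orderedMonomial)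

theorem coe_basis (h : IsPBWSequence K x N) (a : Fin N → ℕ) :
    (h.basis a : A) = orderedMonomial x N a := by
  rw [basis, Module.Basis.map_apply]
  exact congrArg Subtype.val (Module.Basis.span_apply h.linearIndependent a)

end IsPBWSequence

end Straightening

/-! ### Ore extensions and domains from straightening -/

section Ore

variable {K A : Type*} [Field K] [Ring A] [Algebra K A]

/-- The left polynomial `∑ cᵢ x ^ i` with coefficients in a subalgebra. -/
noncomputable def oreSum (R : Subalgebra K A) (x : A) : (ℕ →₀ R) →ₗ[K] A :=
  Finsupp.lsum K fun i => (LinearMap.mulRight K (x ^ i)).comp R.val.toLinearMap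

theorem oreSum_apply (R : Subalgebra K A) (x : A) (c : ℕ →₀ R) :
    oreSum R x c = c.sum fun i a => (a : A) * x ^ i := rfl

@[simp]
theorem oreSum_single (R : Subalgebra K A) (x : A) (i : ℕ) (a : R) :
    oreSum R x (Finsupp.single i a) = (a : A) * x ^ i := by
  rw [oreSum_apply, Finsupp.sum_single_index (by simp)]

theorem eq_and_eq_of_mul_add_eq {R : Subalgebra K A} {x : A}
    (hinj : Function.Injective (oreSum R x)) {r s r' s' : R}
    (h : (r : A) * x + s = r' * x + s') : r = r' ∧ s = s' := by
  have heq : Finsupp.single 1 r + Finsupp.single 0 s =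
      Finsupp.single 1 r' + Finsupp.single 0 s' := hinj (by simpa using h)
  exact ⟨by simpa using DFunLike.congr_fun heq 1, by simpa using DFunLike.congr_fun heq 0⟩

theorem exists_skewDerivation_of_oreSum_injective {R : Subalgebra K A} {x : A}
    (hinj : Function.Injective (oreSum R x))
    (hex : ∀ a : R, ∃ r s : R, x * (a : A) = r * x + s) :
    ∃ (σ : R →ₐ[K] R) (δ : R →ₗ[K] R),
      (∀ a b : R, δ (a * b) = σ a * δ b + δ a * b) ∧
      ∀ a : R, x * (a : A) = (σ a : A) * x + (δ a : A) := by
  choose σ δ h using hex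
  have hadd (a b) : σ (a + b) = σ a + σ b ∧ δ (a + b) = δ a + δ b :=
    eq_and_eq_of_mul_add_eq hinj <| by
      rw [← h]
      push_cast
      rw [mul_add, h, h, add_mul]
      abel
  have hsmul (c : K) (a) : σ (c • a) = c • σ a ∧ δ (c • a) = c • δ a :=
    eq_and_eq_of_mul_add_eq hinj <| by
      rw [← h]
      simp only [Subalgebra.coe_smul, mul_smul_comm, h, smul_add, smul_mul_assoc]
  have hmul (a b) : σ (a * b) = σ a * σ b ∧ δ (a * b) = σ a * δ b + δ a * b :=
    eq_and_eq_of_mul_add_eq hinj <| by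
      rw [← h]
      push_cast
      rw [← mul_assoc, h, add_mul, mul_assoc, h, mul_add, mul_assoc, add_assoc]
  have hone : σ 1 = 1 ∧ δ 1 = 0 := eq_and_eq_of_mul_add_eq hinj (by rw [← h]; simp)
  exact ⟨AlgHom.ofLinearMap ⟨⟨σ, fun a b => (hadd a b).1⟩, fun c a => (hsmul c a).1⟩ hone.1
    fun a b => (hmul a b).1, ⟨⟨δ, fun a b => (hadd a b).2⟩, fun c a => (hsmul c a).2⟩,
    fun a b => (hmul a b).2, h⟩

/-- The elements which an algebra endomorphism multiplies by a nonzero scalar. -/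
def rescaledSubmonoid {B : Type*} [Semiring B] [Algebra K B] (f : B →ₐ[K] B) : Submonoid B where
  carrier := {b | ∃ c : K, c ≠ 0 ∧ f b = c • b}
  one_mem' := ⟨1, one_ne_zero, by simp⟩
  mul_mem' := by
    rintro a b ⟨c, hc, ha⟩ ⟨c', hc', hb⟩
    exact ⟨c * c', mul_ne_zero hc hc', by rw [map_mul, ha, hb, smul_mul_smul_comm]⟩

theorem bijective_of_basis_smul {ι V : Type*} [AddCommGroup V] [Module K V]
    (b : Module.Basis ι K V) (f : V →ₗ[K] V)
    (hf : ∀ i, ∃ c : K, c ≠ 0 ∧ f (b i) = c • b i) : Function.Bijective f := by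
  choose c hc hf using hf
  let g := b.constr K fun i => (c i)⁻¹ • b i
  have hgf : g ∘ₗ f = LinearMap.id := b.ext fun i => by simp [g, hf, hc]
  have hfg : f ∘ₗ g = LinearMap.id := b.ext fun i => by simp [g, hf, hc]
  exact Function.bijective_iff_has_inverse.2
    ⟨g, fun v => LinearMap.congr_fun hgf v, fun v => LinearMap.congr_fun hfg v⟩

namespace IsPBWSequence

variable {x : ℕ → A} {k N : ℕ}

theorem oreSum_injective (h : IsPBWSequence K x (k + 1)) :
    Function.Injective (oreSum (initialAdjoin K x k) (x k)) := by
  let b := Finsupp.basis fun _ : ℕ => (h.mono k.le_succ).basis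
  refine LinearMap.injective_of_linearIndependent (v := b) b.span_eq ?_
  have hb : oreSum (initialAdjoin K x k) (x k) ∘ b = orderedMonomial x (k + 1) ∘
      fun p : Σ _ : ℕ, Fin k → ℕ => Fin.snoc (α := fun _ => ℕ) p.2 p.1 := by
    ext ⟨i, a⟩
    simp [b, Finsupp.coe_basis, coe_basis, orderedMonomial_snoc]
  rw [hb]
  refine h.linearIndependent.comp _ ?_
  rintro ⟨i, a⟩ ⟨j, b⟩ hab
  obtain ⟨rfl, rfl⟩ := Fin.snoc_injective2 hab
  rfl

theorem mem_range_oreSum (h : IsPBWSequence K x (k + 1)) {s : A}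
    (hs : s ∈ initialAdjoin K x (k + 1)) :
    s ∈ LinearMap.range (oreSum (initialAdjoin K x k) (x k)) := by
  rw [← Subalgebra.mem_toSubmodule, ← h.straightens.span_range_orderedMonomial] at hs
  refine Submodule.span_le.2 ?_ hs
  rintro _ ⟨a, rfl⟩
  exact ⟨Finsupp.single (a (Fin.last k)) ⟨_, orderedMonomial_mem_initialAdjoin (Fin.init a)⟩,
    by simp [orderedMonomial]⟩

theorem bijective_of_mul_eq (h : IsPBWSequence K x (k + 1))
    (σ : initialAdjoin K x k →ₐ[K] initialAdjoin K x k)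
    (δ : initialAdjoin K x k → initialAdjoin K x k)
    (hx : ∀ a : initialAdjoin K x k, x k * (a : A) = (σ a : A) * x k + (δ a : A)) :
    Function.Bijective σ := by
  have hvar : ∀ l < k, x l ∈ (rescaledSubmonoid σ).map (initialAdjoin K x k).val := by
    intro l hl
    obtain ⟨c, hc, hcl⟩ := h.straightens k k.lt_succ_self l hl
    refine ⟨⟨x l, mem_initialAdjoin hl⟩, ⟨c, hc, ?_⟩, rfl⟩
    refine (eq_and_eq_of_mul_add_eq h.oreSum_injective
      (s' := ⟨_, initialSpan_pow_le_initialAdjoin 2 hcl⟩) ((hx _).symm.trans ?_)).1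
    simp
  refine bijective_of_basis_smul (h.mono k.le_succ).basis σ.toLinearMap fun a => ?_
  obtain ⟨y, hy, hya⟩ := orderedMonomial_mem hvar a
  rw [Subtype.ext (((h.mono k.le_succ).coe_basis a).trans hya.symm :)]
  exact hy

theorem isOreExtension (h : IsPBWSequence K x (k + 1)) :
    IsOreExtension (initialAdjoin K x k) (initialAdjoin K x (k + 1)) (x k) where
  le := initialAdjoin_mono k.le_succ
  mem := mem_initialAdjoin k.lt_succ_self
  skew := by
    obtain ⟨σ, δ, hδ, hx⟩ := exists_skewDerivation_of_oreSum_injective h.oreSum_injective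
      h.straightens.exists_mul_eq
    exact ⟨AlgEquiv.ofBijective σ (h.bijective_of_mul_eq σ δ hx), δ, hδ, hx⟩
  free := fun s hs => by
    obtain ⟨c, rfl⟩ := h.mem_range_oreSum hs
    exact ⟨c, rfl, fun c' hc' => h.oreSum_injective hc'.symm⟩

theorem isIteratedOreExtension (h : IsPBWSequence K x N) (hgen : initialAdjoin K x N = ⊤) :
    IsIteratedOreExtension K fun k : Fin N => x k :=
  ⟨fun k => initialAdjoin K x k, by simp [initialAdjoin], by simpa using hgen,
    fun k => (h.mono k.isLt).isOreExtension⟩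

end IsPBWSequence

end Ore

section Domain

theorem one_add_pow_succ {α : Type*} [IdemSemiring α] (v : α) (m : ℕ) :
    (1 + v) ^ (m + 1) = (1 + v) ^ m + v ^ (m + 1) := by
  induction m with
  | zero => simp
  | succ m ih =>
    calc (1 + v) ^ (m + 2) = (1 + v) ^ (m + 1) + (1 + v) ^ (m + 1) * v := by
          rw [pow_succ _ (m + 1), mul_add, mul_one]
      _ = (1 + v) ^ (m + 1) + (1 + v) ^ m * v + v ^ (m + 2) := by
          rw [add_assoc]
          nth_rw 2 [ih]
          rw [add_mul, ← pow_succ]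
      _ = (1 + v) ^ (m + 1) + v ^ (m + 2) := by
          rw [pow_succ, mul_add, mul_one, add_assoc ((1 + v) ^ m), add_idem]

theorem pow_mul_le_of_mul_le {α : Type*} [IdemSemiring α] {u r : α} (h : u * r ≤ r * u) (m : ℕ) :
    u ^ m * r ≤ r * u ^ m := by
  induction m with
  | zero => simp
  | succ m ih =>
    calc u ^ (m + 1) * r = u ^ m * (u * r) := by rw [pow_succ, mul_assoc]
      _ ≤ u ^ m * (r * u) := mul_le_mul_right h _
      _ = u ^ m * r * u := (mul_assoc _ _ _).symm
      _ ≤ r * u ^ m * u := mul_le_mul_left ih _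
      _ = r * u ^ (m + 1) := by rw [mul_assoc, ← pow_succ]

variable {K A : Type*} [Field K] [Ring A] [Algebra K A]

/-- The left polynomials in `x` of degree less than `m`, with coefficients in `R`. -/
def oreFiltration (R : Subalgebra K A) (x : A) : ℕ → Submodule K A
  | 0 => ⊥
  | m + 1 => Subalgebra.toSubmodule R * (1 + Submodule.span K {x}) ^ m

variable {R : Subalgebra K A} {x : A} {m n : ℕ}

theorem oreFiltration_succ_eq (m : ℕ) :
    oreFiltration R x (m + 1) =
      oreFiltration R x m + Subalgebra.toSubmodule R * Submodule.span K {x ^ m} := by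
  rw [← Set.singleton_pow, ← Submodule.span_pow]
  cases m with
  | zero => simp [oreFiltration]
  | succ m => rw [oreFiltration, oreFiltration, one_add_pow_succ, mul_add]

theorem oreFiltration_mono : Monotone (oreFiltration R x) :=
  monotone_nat_of_le_succ fun m => (oreFiltration_succ_eq (R := R) (x := x) m).symm ▸ le_sup_left

theorem mul_pow_mem_oreFiltration (a : R) (m : ℕ) : a * x ^ m ∈ oreFiltration R x (m + 1) := by
  rw [oreFiltration_succ_eq]
  exact le_sup_right (a := oreFiltration R x m)
    (Submodule.mul_mem_mul a.2 (Submodule.mem_span_singleton_self _))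

theorem pow_mem_oreFiltration (m : ℕ) : x ^ m ∈ oreFiltration R x (m + 1) := by
  simpa using mul_pow_mem_oreFiltration (1 : R) (x := x) m

theorem coe_mem_oreFiltration_one (a : R) : (a : A) ∈ oreFiltration R x 1 := by
  simpa using mul_pow_mem_oreFiltration a (x := x) 0

theorem exists_oreSum_of_mem_oreFiltration {y : A} (hy : y ∈ oreFiltration R x m) :
    ∃ c : ℕ →₀ R, (∀ i, m ≤ i → c i = 0) ∧ oreSum R x c = y := by
  induction m generalizing y with
  | zero => exact ⟨0, by simp, by rw [map_zero, (Submodule.mem_bot K).1 hy]⟩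
  | succ m ih =>
    rw [oreFiltration_succ_eq] at hy
    obtain ⟨z, hz, w, hw, rfl⟩ := Submodule.mem_sup.1 hy
    obtain ⟨c, hc, rfl⟩ := ih hz
    obtain ⟨a, ha, rfl⟩ := Submodule.mem_mul_span_singleton.1 hw
    refine ⟨c + Finsupp.single m ⟨a, ha⟩, fun i hi => ?_, by simp⟩
    rw [Finsupp.add_apply, hc i (by omega), Finsupp.single_eq_of_ne (by omega), add_zero]

theorem oreSum_mem_oreFiltration {c : ℕ →₀ R} (hc : ∀ i, m ≤ i → c i = 0) :
    oreSum R x c ∈ oreFiltration R x m :=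
  Submodule.sum_mem _ fun i hi => oreFiltration_mono
    (Nat.succ_le_of_lt <| not_le.1 fun h => Finsupp.mem_support_iff.1 hi (hc i h))
    (mul_pow_mem_oreFiltration (c i) i)

section Skew

variable {σ : R ≃ₐ[K] R} {δ : R →ₗ[K] R}

theorem oreFiltration_mul_le (hx : ∀ a : R, x * (a : A) = (σ a : A) * x + (δ a : A)) (m n : ℕ) :
    oreFiltration R x (m + 1) * oreFiltration R x (n + 1) ≤ oreFiltration R x (m + n + 1) := by
  set R' := Subalgebra.toSubmodule R with hR'
  set u := 1 + Submodule.span K {x}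
  have hcomm : u * R' ≤ R' * u := by
    rw [add_mul, mul_add, one_mul, mul_one]
    refine add_le le_sup_left (Submodule.mul_le.2 fun y hy a ha => ?_)
    obtain ⟨c, rfl⟩ := Submodule.mem_span_singleton.1 hy
    rw [smul_mul_assoc, hx ⟨a, ha⟩, add_comm ((σ ⟨a, ha⟩ : R) * x)]
    exact Submodule.smul_mem _ _ (Submodule.add_mem_sup (Subtype.prop _)
      (Submodule.mul_mem_mul (Subtype.prop _) (Submodule.mem_span_singleton_self x)))
  calc R' * u ^ m * (R' * u ^ n) = R' * (u ^ m * R') * u ^ n := by simp only [mul_assoc]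
    _ ≤ R' * (R' * u ^ m) * u ^ n :=
      mul_le_mul_left (mul_le_mul_right (pow_mul_le_of_mul_le hcomm m) R') _
    _ = R' * u ^ (m + n) := by
      rw [← mul_assoc R' R', hR', (Subalgebra.isIdempotentElem_toSubmodule R).eq, mul_assoc,
        ← pow_add]

variable (hx : ∀ a : R, x * (a : A) = (σ a : A) * x + (δ a : A))

include hx

theorem mul_mem_oreFiltration_of_left {f g : A} (hf : f ∈ oreFiltration R x m)
    (hg : g ∈ oreFiltration R x (n + 1)) : f * g ∈ oreFiltration R x (m + n) := by
  cases m with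
  | zero => simp [(Submodule.mem_bot K).1 hf]
  | succ m =>
    rw [Nat.succ_add_eq_add_succ]
    exact oreFiltration_mul_le hx m n (Submodule.mul_mem_mul hf hg)

theorem mul_mem_oreFiltration_of_right {f g : A} (hf : f ∈ oreFiltration R x (m + 1))
    (hg : g ∈ oreFiltration R x n) : f * g ∈ oreFiltration R x (m + n) := by
  cases n with
  | zero => simp [(Submodule.mem_bot K).1 hg]
  | succ n => exact oreFiltration_mul_le hx m n (Submodule.mul_mem_mul hf hg)

theorem pow_mul_sub_mem_oreFiltration (m : ℕ) (a : R) :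
    x ^ m * a - ((σ ^ m) a : R) * x ^ m ∈ oreFiltration R x m := by
  induction m with
  | zero => simp
  | succ m ih =>
    have hstep : x ^ (m + 1) * a - ((σ ^ (m + 1)) a : R) * x ^ (m + 1) =
        x ^ 1 * (x ^ m * a - ((σ ^ m) a : R) * x ^ m) + (δ ((σ ^ m) a) : A) * x ^ m := by
      rw [mul_sub, ← mul_assoc (x ^ 1) (((σ ^ m) a : R) : A), pow_one, hx ((σ ^ m) a), add_mul,
        pow_succ' σ, AlgEquiv.mul_apply, pow_succ' x, mul_assoc x, mul_assoc _ x]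
      abel
    rw [hstep, add_comm m]
    refine add_mem (mul_mem_oreFiltration_of_right hx (pow_mem_oreFiltration 1) ih) ?_
    rw [add_comm]
    exact mul_pow_mem_oreFiltration _ m

theorem mul_sub_mem_oreFiltration (a b : R) {f g : A} (hf : f ∈ oreFiltration R x m)
    (hg : g ∈ oreFiltration R x n) :
    (a * x ^ m + f) * (b * x ^ n + g) - ((a * (σ ^ m) b : R) : A) * x ^ (m + n) ∈
      oreFiltration R x (m + n) := by
  have hexpand : (a * x ^ m + f) * (b * x ^ n + g) - ((a * (σ ^ m) b : R) : A) * x ^ (m + n) =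
      a * (x ^ m * b - ((σ ^ m) b : R) * x ^ m) * x ^ n + f * (b * x ^ n + g) +
        a * x ^ m * g := by
    push_cast
    rw [pow_add]
    noncomm_ring
  rw [hexpand]
  refine add_mem (add_mem ?_ ?_) ?_
  · refine mul_mem_oreFiltration_of_left hx ?_ (pow_mem_oreFiltration n)
    rw [← zero_add m]
    simpa using mul_mem_oreFiltration_of_right hx (coe_mem_oreFiltration_one a)
      (pow_mul_sub_mem_oreFiltration hx m b)
  · exact mul_mem_oreFiltration_of_left hx hf
      (add_mem (mul_pow_mem_oreFiltration b n) (oreFiltration_mono n.le_succ hg))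
  · exact mul_mem_oreFiltration_of_right hx (mul_pow_mem_oreFiltration a m) hg

end Skew

namespace IsOreExtension

variable {S : Subalgebra K A}

theorem exists_leading (h : IsOreExtension R S x) {s : A} (hs : s ∈ S) (hs0 : s ≠ 0) :
    ∃ (m : ℕ) (a : R) (f : A), a ≠ 0 ∧ f ∈ oreFiltration R x m ∧ s = a * x ^ m + f := by
  obtain ⟨c, hc, -⟩ := h.free s hs
  have hsupp : c.support.Nonempty := by
    rw [Finsupp.support_nonempty_iff]
    rintro rfl
    exact hs0 (by simpa using hc)
  set m := c.support.max' hsupp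
  refine ⟨m, c m, oreSum R x (c.erase m), Finsupp.mem_support_iff.1 (c.support.max'_mem hsupp),
    oreSum_mem_oreFiltration fun i hi => ?_, ?_⟩
  · rcases hi.eq_or_lt with rfl | hi
    · exact Finsupp.erase_same
    · rw [Finsupp.erase_ne hi.ne']
      by_contra hci
      exact hi.not_ge (c.support.le_max' i (Finsupp.mem_support_iff.2 hci))
  · rw [hc, ← oreSum_apply, ← oreSum_single, ← map_add, Finsupp.single_add_erase]

theorem mul_pow_notMem_oreFiltration (h : IsOreExtension R S x) {a : R} (ha : a ≠ 0) (m : ℕ) :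
    a * x ^ m ∉ oreFiltration R x m := by
  intro hmem
  obtain ⟨c, hc, hca⟩ := exists_oreSum_of_mem_oreFiltration hmem
  obtain rfl : c = Finsupp.single m a :=
    (h.free _ (mul_mem (h.le a.2) (pow_mem h.mem m))).unique hca.symm (oreSum_single R x m a).symm
  exact ha (by simpa using hc m le_rfl)

theorem eq_zero_or_eq_zero (h : IsOreExtension R S x)
    (hR : ∀ a b : R, a * b = 0 → a = 0 ∨ b = 0) {s t : A} (hs : s ∈ S) (ht : t ∈ S)
    (hst : s * t = 0) : s = 0 ∨ t = 0 := by
  by_contra! hne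
  obtain ⟨σ, δ, -, hx⟩ := h.skew
  obtain ⟨m, a, f, ha, hf, rfl⟩ := h.exists_leading hs hne.1
  obtain ⟨n, b, g, hb, hg, rfl⟩ := h.exists_leading ht hne.2
  have hlead := mul_sub_mem_oreFiltration hx a b hf hg
  rw [hst, zero_sub, neg_mem_iff] at hlead
  refine h.mul_pow_notMem_oreFiltration (fun hab => ?_) _ hlead
  exact (hR _ _ hab).elim ha fun hσb => hb ((map_eq_zero_iff _ (σ ^ m).injective).1 hσb)

end IsOreExtension

namespace IsPBWSequence

variable {x : ℕ → A} {k N : ℕ}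

theorem eq_zero_or_eq_zero (h : IsPBWSequence K x N) {s t : A} (hs : s ∈ initialAdjoin K x N)
    (ht : t ∈ initialAdjoin K x N) (hst : s * t = 0) : s = 0 ∨ t = 0 := by
  induction N generalizing s t with
  | zero =>
    have : Nontrivial A := ⟨⟨_, _, h.linearIndependent.ne_zero 0⟩⟩
    have hbot : initialAdjoin K x 0 = ⊥ := by simp [initialAdjoin]
    rw [hbot, Algebra.mem_bot] at hs ht
    obtain ⟨a, rfl⟩ := hs
    obtain ⟨b, rfl⟩ := ht
    rw [← map_mul, map_eq_zero] at hst
    simpa using hst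
  | succ k ih =>
    refine h.isOreExtension.eq_zero_or_eq_zero (fun a b hab => ?_) hs ht hst
    simpa using ih (h.mono k.le_succ) a.2 b.2 (congrArg Subtype.val hab)

theorem isDomain (h : IsPBWSequence K x N) (hgen : initialAdjoin K x N = ⊤) : IsDomain A := by
  have : Nontrivial A := ⟨⟨_, _, h.linearIndependent.ne_zero 0⟩⟩
  have : NoZeroDivisors A :=
    ⟨h.eq_zero_or_eq_zero (hgen ▸ Algebra.mem_top) (hgen ▸ Algebra.mem_top)⟩
  exact NoZeroDivisors.to_isDomain A

end IsPBWSequence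

end Domain

/-! ### Hilbert series and presentations from straightening -/

section PBW

variable {K A : Type*} [Field K] [Ring A] [Algebra K A] {x : ℕ → A} {N : ℕ}

theorem finrank_homogeneousSubmodule {ι : Type*} [Fintype ι] (d : ℕ) :
    Module.finrank K (MvPolynomial.homogeneousSubmodule ι K d) =
      Nat.card {a : ι → ℕ // ∑ i, a i = d} := by
  rw [MvPolynomial.homogeneousSubmodule_eq_finsupp_supported]
  refine (Module.finrank_eq_nat_card_basis
    (MvPolynomial.basisRestrictSupport K {a : ι →₀ ℕ | a.degree = d})).trans
    (Nat.card_congr (Equiv.subtypeEquiv Finsupp.equivFunOnFinite fun a => ?_))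
  simp [Finsupp.degree_eq_sum]

namespace IsPBWSequence

theorem isInternal_initialSpan_pow (h : IsPBWSequence K x N) (hgen : initialAdjoin K x N = ⊤) :
    DirectSum.IsInternal fun d : ℕ => initialSpan K x N ^ d := by
  simp only [h.straightens.initialSpan_pow_eq]
  refine DirectSum.isInternal_submodule_of_iSupIndep_of_iSup_eq_top (fun d => ?_) ?_
  · refine (h.linearIndependent.disjoint_span_image (s := {a | ∑ i, a i = d})
      (t := {a | ∑ i, a i ≠ d}) (Set.disjoint_left.2 fun a ha ha' => ha' ha)).mono_right ?_
    exact iSup₂_le fun e he => Submodule.span_mono (Set.image_mono fun a ha => ha.trans_ne he)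
  · simp only [← h.straightens.initialSpan_pow_eq]
    rw [← toSubmodule_initialAdjoin, hgen, Algebra.top_toSubmodule]

theorem finrank_initialSpan_pow (h : IsPBWSequence K x N) (d : ℕ) :
    Module.finrank K ↥(initialSpan K x N ^ d) = Nat.card {a : Fin N → ℕ // ∑ i, a i = d} := by
  rw [h.straightens.initialSpan_pow_eq, orderedSpan, Set.image_eq_range]
  exact Module.finrank_eq_nat_card_basis
    (Module.Basis.span (h.linearIndependent.comp _ Subtype.val_injective))

theorem hilbertSeries_initialSpan_pow (h : IsPBWSequence K x N) {ι : Type*}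
    (e : ι ≃ Fin N) :
    hilbertSeries (fun d : ℕ => initialSpan K x N ^ d) =
      hilbertSeries (MvPolynomial.homogeneousSubmodule ι K) := by
  have : Fintype ι := Fintype.ofEquiv _ e.symm
  ext d
  rw [hilbertSeries, hilbertSeries, PowerSeries.coeff_mk, PowerSeries.coeff_mk,
    h.finrank_initialSpan_pow, finrank_homogeneousSubmodule]
  refine Nat.card_congr (Equiv.subtypeEquiv (Equiv.arrowCongr e.symm (Equiv.refl ℕ)) fun a => ?_)
  simp [Equiv.sum_comp e a]

end IsPBWSequence

theorem injective_of_straightens {B : Type*} [Ring B] [Algebra K B] {y : ℕ → B}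
    (hy : Straightens K y N) (hgen : initialAdjoin K y N = ⊤) (f : B →ₐ[K] A)
    (hli : LinearIndependent K (orderedMonomial (f ∘ y) N)) : Function.Injective f := by
  refine LinearMap.injective_of_linearIndependent (f := f.toLinearMap) (v := orderedMonomial y N)
    (by rw [hy.span_range_orderedMonomial, hgen, Algebra.top_toSubmodule]) ?_
  have hmap : f.toLinearMap ∘ orderedMonomial y N = orderedMonomial (f ∘ y) N :=
    funext (map_orderedMonomial y N (f : B →* A))
  rwa [hmap]

end PBW

/-! ### Quadratic relations from the quantum Serre relations -/

section SerreRelations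

variable {K A : Type*} [Field K] [Ring A] [Algebra K A] {q c d : K} {a b x y u v : A}

/-- The quantum Serre expression `a² b - (q + q⁻¹) a b a + b a²`. -/
def serreElt (q : K) (a b : A) : A := a ^ 2 * b - (q + q⁻¹) • (a * b * a) + b * a ^ 2

/-- The `q`-commutator `a x - q x a`; on the elements `Z_{i,j}` this is the action `ad E`. -/
def qComm (q : K) (a x : A) : A := a * x - q • (x * a)

/-- The elements `a` and `b` commute up to the scalar `c`: `a b = c b a`. -/
def QCommute (c : K) (a b : A) : Prop := a * b = c • (b * a)

theorem map_qComm {B : Type*} [Ring B] [Algebra K B] (f : A →ₐ[K] B) (q : K) (a x : A) :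
    f (qComm q a x) = qComm q (f a) (f x) := by
  simp [qComm]

namespace QCommute

theorem of_commute (h : Commute a b) : QCommute (1 : K) a b := by
  rw [QCommute, one_smul, h.eq]

theorem commute (h : QCommute (1 : K) a b) : Commute a b := by
  rwa [QCommute, one_smul] at h

theorem mul_right (hx : QCommute c a x) (hy : QCommute d a y) : QCommute (c * d) a (x * y) := by
  rw [QCommute, ← mul_assoc, hx, smul_mul_assoc, mul_assoc, hy, mul_smul_comm, smul_smul, mul_assoc]

theorem mul_left (hx : QCommute c x a) (hy : QCommute d y a) : QCommute (c * d) (x * y) a := by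
  rw [QCommute, mul_assoc, hy, mul_smul_comm, ← mul_assoc, hx, smul_mul_assoc, smul_smul,
    mul_assoc, mul_comm d]

theorem qComm_right (hx : QCommute c b x) (ha : Commute b a) : QCommute c b (qComm q a x) := by
  have hax : QCommute c b (a * x) := by simpa using (of_commute ha).mul_right hx
  have hxa : QCommute c b (x * a) := by simpa using hx.mul_right (of_commute ha)
  rw [QCommute, qComm, mul_sub, mul_smul_comm, hax, hxa, sub_mul, smul_mul_assoc, smul_sub,
    smul_comm c q]

theorem qComm_left (hx : QCommute c x b) (ha : Commute a b) : QCommute c (qComm q a x) b := by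
  have hax : QCommute c (a * x) b := by simpa using (of_commute ha).mul_left hx
  have hxa : QCommute c (x * a) b := by simpa using hx.mul_left (of_commute ha)
  rw [QCommute, qComm, sub_mul, smul_mul_assoc, hax, hxa, mul_sub, mul_smul_comm, smul_sub,
    smul_comm c q]

end QCommute

theorem commute_qComm_right (hx : Commute b x) (ha : Commute b a) : Commute b (qComm q a x) :=
  ((QCommute.of_commute hx).qComm_right ha).commute

theorem commute_qComm_left (hx : Commute x b) (ha : Commute a b) : Commute (qComm q a x) b :=
  (commute_qComm_right hx.symm ha.symm).symm

theorem qComm_left_comm (h : Commute a b) (x : A) :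
    qComm q a (qComm q b x) = qComm q b (qComm q a x) := by
  simp only [qComm, mul_sub, sub_mul, smul_mul_assoc, mul_smul_comm, mul_assoc, h.left_comm, h.eq]
  module

theorem serreElt_qComm_eq_zero (h : serreElt q a b = 0) (hx : Commute a x) :
    serreElt q a (qComm q b x) = 0 := by
  have hexpand : serreElt q a (qComm q b x) = serreElt q a b * x - q • (x * serreElt q a b) := by
    simp only [serreElt, qComm, mul_sub, sub_mul, mul_add, add_mul, smul_mul_assoc,
      mul_smul_comm, mul_assoc, pow_two, hx.left_comm, hx.eq]
    module
  rw [hexpand, h, zero_mul, mul_zero, smul_zero, sub_zero]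

theorem qCommute_self_qComm (hq : q ≠ 0) (h : serreElt q a x = 0) :
    QCommute q⁻¹ a (qComm q a x) := by
  rw [QCommute, ← sub_eq_zero, ← h]
  simp only [serreElt, qComm, mul_sub, sub_mul, smul_mul_assoc, mul_smul_comm, mul_assoc, pow_two]
  match_scalars <;> field_simp
  ring

theorem qCommute_qComm_self (hq : q ≠ 0) (h : serreElt q x a = 0) :
    QCommute q x (qComm q a x) := by
  have hexpand : x * qComm q a x - q • (qComm q a x * x) = -(q • serreElt q x a) := by
    simp only [serreElt, qComm, mul_sub, sub_mul, smul_mul_assoc, mul_smul_comm, mul_assoc,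
      pow_two]
    match_scalars <;> field_simp
    ring
  rw [QCommute, ← sub_eq_zero, hexpand, h, smul_zero, neg_zero]

theorem add_inv_ne_zero (hq : q ≠ 0) (hq2 : q ^ 2 + 1 ≠ 0) : q + q⁻¹ ≠ 0 := by
  rw [← mul_ne_zero_iff_left hq, mul_add, mul_inv_cancel₀ hq, ← pow_two]
  exact hq2

theorem commute_qComm_qComm (hq : q ≠ 0) (hq2 : q ^ 2 + 1 ≠ 0) (hb : serreElt q a b = 0)
    (hy : serreElt q a y = 0) (hby : Commute b y) : Commute a (qComm q b (qComm q a y)) := by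
  have hexpand : (q + q⁻¹) • (a * qComm q b (qComm q a y) - qComm q b (qComm q a y) * a) =
      b * serreElt q a y + q ^ 2 • (y * serreElt q a b) - serreElt q a b * y
        - q ^ 2 • (serreElt q a y * b) := by
    simp only [serreElt, qComm, mul_sub, sub_mul, mul_add, add_mul, smul_mul_assoc,
      mul_smul_comm, mul_assoc, pow_two, hby.left_comm, hby.eq]
    match_scalars <;> field_simp <;> ring
  simp only [hb, hy, mul_zero, zero_mul, smul_zero, sub_zero, add_zero] at hexpand
  exact sub_eq_zero.1 ((smul_eq_zero.1 hexpand).resolve_left (add_inv_ne_zero hq hq2))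

theorem mul_qComm_sub_qComm_mul (h : x * y - y * x = c • (u * v)) (hx : Commute a x)
    (hu : Commute a u) : x * qComm q a y - qComm q a y * x = c • (u * qComm q a v) := by
  have hexpand : x * qComm q a y - qComm q a y * x - c • (u * qComm q a v) =
      qComm q a (x * y - y * x - c • (u * v)) := by
    simp only [qComm, mul_sub, sub_mul, smul_mul_assoc, mul_smul_comm, mul_assoc, hx.left_comm,
      hu.left_comm, hx.eq]
    module
  rw [← sub_eq_zero, hexpand, sub_eq_zero.2 h, qComm, mul_zero, zero_mul, smul_zero, sub_zero]

/- Apply `z ↦ a z - q² z a` to both sides of `x y = q y x`. -/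
theorem QCommute.qComm_mul_add (h : QCommute q x y) (a : A) :
    qComm q a x * y + q • (x * qComm q a y) =
      q • (qComm q a y * x) + q ^ 2 • (y * qComm q a x) := by
  have hexpand : qComm q a x * y + q • (x * qComm q a y) -
      (q • (qComm q a y * x) + q ^ 2 • (y * qComm q a x)) =
      a * (x * y - q • (y * x)) - q ^ 2 • ((x * y - q • (y * x)) * a) := by
    simp only [qComm, mul_sub, sub_mul, smul_mul_assoc, mul_smul_comm, mul_assoc]
    module
  rw [← sub_eq_zero, hexpand, sub_eq_zero.2 h, mul_zero, zero_mul, smul_zero, sub_zero]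

theorem QCommute.qComm_qComm (hq : q ≠ 0) (hq2 : q ^ 2 + 1 ≠ 0) (h : QCommute q x y)
    (hx : QCommute q⁻¹ a (qComm q a x)) (hy : QCommute q⁻¹ a (qComm q a y)) :
    QCommute q (qComm q a x) (qComm q a y) := by
  have hskew := h.qComm_mul_add a
  have hax : a * x = qComm q a x + q • (x * a) := by rw [qComm, sub_add_cancel]
  have hay : a * y = qComm q a y + q • (y * a) := by rw [qComm, sub_add_cancel]
  generalize qComm q a x = x' at *
  generalize qComm q a y = y' at *
  have hax' z : a * (x * z) = x' * z + q • (x * (a * z)) := by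
    rw [← mul_assoc, hax, add_mul, smul_mul_assoc, mul_assoc]
  have hay' z : a * (y * z) = y' * z + q • (y * (a * z)) := by
    rw [← mul_assoc, hay, add_mul, smul_mul_assoc, mul_assoc]
  have hx' z : a * (x' * z) = q⁻¹ • (x' * (a * z)) := by
    rw [← mul_assoc, hx, smul_mul_assoc, mul_assoc]
  have hy' z : a * (y' * z) = q⁻¹ • (y' * (a * z)) := by
    rw [← mul_assoc, hy, smul_mul_assoc, mul_assoc]
  have hexpand : (q + q⁻¹) • (x' * y' - q • (y' * x')) =
      a * (x' * y + q • (x * y') - (q • (y' * x) + q ^ 2 • (y * x'))) -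
      (x' * y + q • (x * y') - (q • (y' * x) + q ^ 2 • (y * x'))) * a := by
    rw [QCommute] at hx hy
    simp only [mul_sub, sub_mul, mul_add, add_mul, smul_mul_assoc, mul_smul_comm, mul_assoc,
      hx', hy', hax', hay', hx, hy, hax, hay]
    match_scalars <;> field_simp <;> ring
  rw [sub_eq_zero.2 hskew, mul_zero, zero_mul, sub_zero] at hexpand
  exact sub_eq_zero.1 ((smul_eq_zero.1 hexpand).resolve_left (add_inv_ne_zero hq hq2))

/-- A family indexed by the nodes of the Dynkin diagram `A_∞`, numbered by `ℤ`, which satisfies the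
quantum Serre relations. -/
structure IsSerreFamily (q : K) (e : ℤ → A) : Prop where
  commute : ∀ {i j : ℤ}, i + 1 < j ∨ j + 1 < i → Commute (e i) (e j)
  serre_eq_zero : ∀ {i j : ℤ}, i + 1 = j ∨ j + 1 = i → serreElt q (e i) (e j) = 0

/-- The elements `Z_{i,j}` of a family of root vectors with `β` at node `0`, the roots `ν_j` at the
positive and the roots `μ_i` at the negative nodes (numbered from `0`). -/
def grid (q : K) (e : ℤ → A) : ℕ → ℕ → A
  | 0, 0 => e 0
  | 0, j + 1 => qComm q (e (j + 1)) (grid q e 0 j)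
  | i + 1, j => qComm q (e (-(i + 1))) (grid q e i j)

variable {e : ℤ → A}

theorem grid_zero : grid q e 0 0 = e 0 := by rw [grid]

theorem grid_succ_left (i j : ℕ) :
    grid q e (i + 1) j = qComm q (e (-(i + 1))) (grid q e i j) := by rw [grid]

theorem map_grid {B : Type*} [Ring B] [Algebra K B] (f : A →ₐ[K] B) (i j : ℕ) :
    f (grid q e i j) = grid q (f ∘ e) i j := by
  induction i with
  | zero =>
    induction j with
    | zero => simp only [grid_zero, Function.comp_apply]
    | succ j ih => rw [grid, grid, map_qComm, ih, Function.comp_apply]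
  | succ i ih => rw [grid_succ_left, grid_succ_left, map_qComm, ih, Function.comp_apply]

namespace IsSerreFamily

theorem neg (he : IsSerreFamily q e) : IsSerreFamily q fun i => e (-i) where
  commute h := he.commute (by omega)
  serre_eq_zero h := he.serre_eq_zero (by omega)

theorem grid_succ_right (he : IsSerreFamily q e) (i j : ℕ) :
    grid q e i (j + 1) = qComm q (e (j + 1)) (grid q e i j) := by
  induction i with
  | zero => rw [grid]
  | succ i ih =>
    rw [grid_succ_left, ih, grid_succ_left, qComm_left_comm (he.commute (by omega))]

theorem grid_neg (he : IsSerreFamily q e) (i j : ℕ) :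
    grid q (fun i => e (-i)) i j = grid q e j i := by
  induction i generalizing j with
  | zero =>
    induction j with
    | zero => simp only [grid_zero, neg_zero]
    | succ j ih => rw [he.neg.grid_succ_right, ih, grid_succ_left]
  | succ i ih => rw [grid_succ_left, ih, he.grid_succ_right, neg_neg]

theorem commute_grid_of_lt (he : IsSerreFamily q e) {k j : ℕ} (i : ℕ) (h : j < k) :
    Commute (e (k + 1)) (grid q e i j) := by
  induction i with
  | zero =>
    induction j with
    | zero => exact grid_zero (q := q) (e := e) ▸ he.commute (by omega)
    | succ j ih =>
      rw [he.grid_succ_right]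
      exact commute_qComm_right (ih (by omega)) (he.commute (by omega))
  | succ i ih =>
    rw [grid_succ_left]
    exact commute_qComm_right ih (he.commute (by omega))

theorem serreElt_grid_zero (he : IsSerreFamily q e) (j : ℕ) :
    serreElt q (e (j + 1)) (grid q e 0 j) = 0 := by
  cases j with
  | zero => exact grid_zero (q := q) (e := e) ▸ he.serre_eq_zero (by simp)
  | succ j =>
    rw [he.grid_succ_right]
    exact serreElt_qComm_eq_zero (he.serre_eq_zero (by simp))
      (he.commute_grid_of_lt 0 j.lt_succ_self)

theorem qCommute_grid_succ (he : IsSerreFamily q e) (hq : q ≠ 0) (i j : ℕ) :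
    QCommute q⁻¹ (e (j + 1)) (grid q e i (j + 1)) := by
  induction i with
  | zero =>
    rw [he.grid_succ_right]
    exact qCommute_self_qComm hq (he.serreElt_grid_zero j)
  | succ i ih =>
    rw [grid_succ_left]
    exact ih.qComm_right (he.commute (by omega))

theorem commute_grid_of_gt (he : IsSerreFamily q e) (hq : q ≠ 0) (hq2 : q ^ 2 + 1 ≠ 0) {k j : ℕ}
    (i : ℕ) (h : k + 2 ≤ j) : Commute (e (k + 1)) (grid q e i j) := by
  induction i with
  | zero =>
    induction j, h using Nat.le_induction with
    | base =>
      rw [he.grid_succ_right, he.grid_succ_right]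
      exact commute_qComm_qComm hq hq2 (he.serre_eq_zero (by simp)) (he.serreElt_grid_zero k)
        (he.commute_grid_of_lt 0 k.lt_succ_self)
    | succ j hj ih =>
      rw [he.grid_succ_right]
      exact commute_qComm_right ih (he.commute (by omega))
  | succ i ih =>
    rw [grid_succ_left]
    exact commute_qComm_right ih (he.commute (by omega))

theorem commute_right_grid (he : IsSerreFamily q e) (hq : q ≠ 0) (hq2 : q ^ 2 + 1 ≠ 0) {k j : ℕ}
    (i : ℕ) (h : j < k ∨ k + 1 < j) : Commute (e (k + 1)) (grid q e i j) :=
  h.elim (he.commute_grid_of_lt i) (he.commute_grid_of_gt hq hq2 i)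

theorem commute_left_grid (he : IsSerreFamily q e) (hq : q ≠ 0) (hq2 : q ^ 2 + 1 ≠ 0) {k i : ℕ}
    (j : ℕ) (h : i < k ∨ k + 1 < i) : Commute (e (-(k + 1))) (grid q e i j) := by
  rw [← he.grid_neg]
  exact he.neg.commute_right_grid hq hq2 j h

theorem qCommute_grid_succ_left (he : IsSerreFamily q e) (hq : q ≠ 0) (i j : ℕ) :
    QCommute q⁻¹ (e (-(i + 1))) (grid q e (i + 1) j) := by
  rw [← he.grid_neg]
  exact he.neg.qCommute_grid_succ hq j i

theorem qCommute_grid_row (he : IsSerreFamily q e) (hq : q ≠ 0) (hq2 : q ^ 2 + 1 ≠ 0) (i : ℕ)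
    {j k : ℕ} (h : j < k) : QCommute q (grid q e i j) (grid q e i k) := by
  induction i with
  | succ i ih =>
    have hj := he.qCommute_grid_succ_left hq i j
    have hk := he.qCommute_grid_succ_left hq i k
    simp only [grid_succ_left] at hj hk ⊢
    exact ih.qComm_qComm hq hq2 hj hk
  | zero =>
  induction j with
  | succ j ih =>
    rw [he.grid_succ_right]
    exact (ih (by omega)).qComm_left (he.commute_right_grid hq hq2 0 (by omega))
  | zero =>
  induction k, Nat.succ_le_of_lt h using Nat.le_induction with
  | base =>
    rw [he.grid_succ_right, grid_zero]
    exact qCommute_qComm_self hq (he.serre_eq_zero (by simp))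
  | succ k hk ih =>
    rw [he.grid_succ_right 0 k]
    exact (ih hk).qComm_right (he.commute_right_grid hq hq2 0 (by omega)).symm

theorem qCommute_grid_col (he : IsSerreFamily q e) (hq : q ≠ 0) (hq2 : q ^ 2 + 1 ≠ 0) {i k : ℕ}
    (j : ℕ) (h : i < k) : QCommute q (grid q e i j) (grid q e k j) := by
  simpa only [he.grid_neg] using he.neg.qCommute_grid_row hq hq2 j h

theorem commute_grid_one (he : IsSerreFamily q e) (hq : q ≠ 0) (hq2 : q ^ 2 + 1 ≠ 0) :
    Commute (grid q e 0 1) (grid q e 1 0) := by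
  have hrow := (he.qCommute_grid_row hq hq2 0 Nat.zero_lt_one).qComm_mul_add (e (-(0 + 1)))
  have hcol := (he.qCommute_grid_col hq hq2 0 Nat.zero_lt_one).qComm_mul_add (e (0 + 1))
  have hleft j := grid_succ_left (q := q) (e := e) 0 j
  have hright i := he.grid_succ_right i 0
  simp only [Nat.cast_zero] at hleft hright
  simp only [← hleft, ← hright] at hrow hcol
  have hsmul :
      (q ^ 2 + 1) • (grid q e 0 1 * grid q e 1 0 - grid q e 1 0 * grid q e 0 1) = 0 := by
    linear_combination (norm := module) hcol - hrow
  exact sub_eq_zero.1 ((smul_eq_zero.1 hsmul).resolve_left hq2)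

theorem commute_grid_anti (he : IsSerreFamily q e) (hq : q ≠ 0) (hq2 : q ^ 2 + 1 ≠ 0)
    {i j s t : ℕ} (his : i < s) (htj : t < j) : Commute (grid q e i j) (grid q e s t) := by
  induction i with
  | succ i ih =>
    rw [grid_succ_left]
    exact commute_qComm_left (ih (by omega)) (he.commute_left_grid hq hq2 t (by omega))
  | zero =>
  induction t with
  | succ t ih =>
    rw [he.grid_succ_right s]
    exact commute_qComm_right (ih (by omega)) (he.commute_right_grid hq hq2 0 (by omega)).symm
  | zero =>
  induction s, Nat.succ_le_of_lt his using Nat.le_induction with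
  | succ s hs ih =>
    rw [grid_succ_left]
    exact commute_qComm_right (ih hs) (he.commute_left_grid hq hq2 j (by omega)).symm
  | base =>
  induction j, Nat.succ_le_of_lt htj using Nat.le_induction with
  | succ j hj ih =>
    rw [he.grid_succ_right]
    exact commute_qComm_left (ih hj) (he.commute_right_grid hq hq2 1 (by omega))
  | base => exact he.commute_grid_one hq hq2

theorem grid_diag (he : IsSerreFamily q e) (hq : q ≠ 0) (hq2 : q ^ 2 + 1 ≠ 0) {i j s t : ℕ}
    (his : i < s) (hjt : j < t) :
    grid q e i j * grid q e s t - grid q e s t * grid q e i j =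
      (q - q⁻¹) • (grid q e i t * grid q e s j) := by
  induction s, Nat.succ_le_of_lt his using Nat.le_induction with
  | succ s hs ih =>
    rw [grid_succ_left, grid_succ_left]
    exact mul_qComm_sub_qComm_mul (ih hs) (he.commute_left_grid hq hq2 j (by omega))
      (he.commute_left_grid hq hq2 t (by omega))
  | base =>
    have hrow := (he.qCommute_grid_row hq hq2 i hjt).qComm_mul_add (e (-(i + 1)))
    simp only [← grid_succ_left] at hrow
    rw [← (he.commute_grid_anti hq hq2 i.lt_succ_self hjt).eq] at hrow
    have hsmul : q • (grid q e i j * grid q e (i + 1) t - grid q e (i + 1) t * grid q e i j) =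
        (q ^ 2 - 1) • (grid q e i t * grid q e (i + 1) j) := by
      linear_combination (norm := module) hrow
    rw [← inv_smul_smul₀ hq (_ - _), hsmul, smul_smul]
    congr 1
    field_simp

end IsSerreFamily

end SerreRelations

/-! ### The positive part and its Verma module structure -/

section SerreDerivative

open TrivSqZeroExt

variable {K A : Type*} [Field K] [Ring A] [Algebra K A] {q c : K} {x y m n e t t' : A}

theorem map_serreElt {B : Type*} [Ring B] [Algebra K B] (f : A →ₐ[K] B) (q : K) (a b : A) :
    f (serreElt q a b) = serreElt q (f a) (f b) := by
  simp [serreElt]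

theorem serreElt_smul_smul (q c d : K) (a b : A) :
    serreElt q (c • a) (d • b) = (c ^ 2 * d) • serreElt q a b := by
  simp only [serreElt, pow_two, smul_mul_assoc, mul_smul_comm]
  module

/-- The derivative of the quantum Serre expression at `(x, y)` in the direction `(m, n)`. -/
def serreDeriv (q : K) (x y m n : A) : A :=
  x * m * y + m * x * y + x * x * n -
    (q + q⁻¹) • (x * y * m + x * n * x + m * y * x) + (y * x * m + y * m * x + n * x * x)

theorem inl_add_inr_mul_inl_add_inr (x y m n : A) :
    (inl x + inr m : DualNumber A) * (inl y + inr n) = inl (x * y) + inr (x * n + m * y) := by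
  ext <;> simp

theorem serreElt_inl_add_inr (q : K) (x y m n : A) :
    serreElt q (inl x + inr m : DualNumber A) (inl y + inr n) =
      inl (serreElt q x y) + inr (serreDeriv q x y m n) := by
  ext
  · simp [serreElt]
  · simp [serreElt, serreDeriv, pow_two, mul_add, add_mul, mul_assoc]
    abel

theorem serreElt_mul_sub_mul_serreElt (q : K) (x y e : A) :
    serreElt q x y * e - e * serreElt q x y =
      serreDeriv q x y (x * e - e * x) (y * e - e * y) := by
  simp only [serreElt, serreDeriv, pow_two, mul_sub, sub_mul, mul_add, add_mul, mul_assoc,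
    smul_mul_assoc, mul_smul_comm]
  module

theorem serreDeriv_zero_zero : serreDeriv q x y 0 0 = 0 := by
  simp [serreDeriv]

theorem serreDeriv_left_eq_zero (hc : c ≠ 0) (hqc : q + q⁻¹ = c + c⁻¹)
    (hx : QCommute (c ^ 2) t x) (hy : QCommute c⁻¹ t y) : serreDeriv q x y t 0 = 0 := by
  rw [QCommute] at hx hy
  simp only [serreDeriv, hqc, mul_assoc, hx, hy, mul_smul_comm, smul_mul_assoc,
    smul_smul, mul_zero, zero_mul]
  match_scalars <;> field_simp <;> ring

theorem serreDeriv_right_eq_zero (hc : c ≠ 0) (hqc : q + q⁻¹ = c + c⁻¹) (hx : QCommute c t x) :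
    serreDeriv q x y 0 t = 0 := by
  rw [QCommute] at hx
  simp only [serreDeriv, hqc, mul_assoc, hx, mul_smul_comm, smul_mul_assoc, smul_smul,
    mul_zero, zero_mul]
  match_scalars
  field_simp
  ring

theorem serreDeriv_smul_sub (q a : K) (x y m n m' n' : A) :
    serreDeriv q x y (a • (m - m')) (a • (n - n')) =
      a • (serreDeriv q x y m n - serreDeriv q x y m' n') := by
  simp only [serreDeriv, mul_sub, sub_mul, smul_mul_assoc, mul_smul_comm]
  module

end SerreDerivative

section Cartan

variable {r : ℕ} {i j : Fin r}

theorem cartan_comm (i j : Fin r) : CartanMatrix.A r i j = CartanMatrix.A r j i :=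
  congrFun (congrFun (CartanMatrix.A_transpose r).symm i) j

theorem cartan_self (i : Fin r) : CartanMatrix.A r i i = 2 := by simp [CartanMatrix.A]

theorem ne_of_cartan_ne_two (h : CartanMatrix.A r i j ≠ 2) : i ≠ j := by
  rintro rfl
  exact h (cartan_self i)

theorem toWeight_simpleRoot (i j : Fin r) :
    toWeight (simpleRoot i) j = CartanMatrix.A r j i := by
  simp [toWeight, simpleRoot, Pi.single_apply]

theorem pairing_simpleRoot (i : Fin r) (ζ : WeightLattice r) : pairing (simpleRoot i) ζ = ζ i := by
  simp [pairing, simpleRoot, Pi.single_apply]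

variable {K A : Type*} [Field K] [Ring A] [Algebra K A] {q c : K} {x : Fin r → A} {k : Fin r}
  {t t' : A}

theorem serreDeriv_single_eq_zero (hc : c ≠ 0) (hqc : q + q⁻¹ = c + c⁻¹)
    (ht : ∀ l, QCommute (c ^ CartanMatrix.A r l k) t (x l)) (h : CartanMatrix.A r i j = -1) :
    serreDeriv q (x i) (x j) (if i = k then t else 0) (if j = k then t else 0) = 0 := by
  have hij : i ≠ j := ne_of_cartan_ne_two (by omega)
  by_cases hi : i = k
  · subst hi
    rw [if_pos rfl, if_neg hij.symm]
    refine serreDeriv_left_eq_zero hc hqc ?_ ?_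
    · simpa only [cartan_self, zpow_ofNat] using ht i
    · simpa only [cartan_comm j, h, zpow_neg_one] using ht j
  by_cases hj : j = k
  · subst hj
    rw [if_neg hij, if_pos rfl]
    refine serreDeriv_right_eq_zero (inv_ne_zero hc) (by rw [hqc, inv_inv, add_comm]) ?_
    simpa only [h, zpow_neg_one] using ht i
  · rw [if_neg hi, if_neg hj, serreDeriv_zero_zero]

theorem serreDeriv_single_smul_sub_eq_zero (hc : c ≠ 0) (hqc : q + q⁻¹ = c + c⁻¹)
    (ht : ∀ l, QCommute (c ^ CartanMatrix.A r l k) t (x l))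
    (ht' : ∀ l, QCommute (c⁻¹ ^ CartanMatrix.A r l k) t' (x l)) (a : K)
    (h : CartanMatrix.A r i j = -1) :
    serreDeriv q (x i) (x j) (if i = k then a • (t - t') else 0)
      (if j = k then a • (t - t') else 0) = 0 := by
  have hsplit (l : Fin r) : (if l = k then a • (t - t') else 0) =
      a • ((if l = k then t else 0) - if l = k then t' else 0) := by
    split_ifs <;> simp
  rw [hsplit, hsplit, serreDeriv_smul_sub, serreDeriv_single_eq_zero hc hqc ht h,
    serreDeriv_single_eq_zero (inv_ne_zero hc) (by rw [hqc, inv_inv, add_comm]) ht' h, sub_self,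
    smul_zero]

theorem mul_single_add_single_mul_comm {s : A}
    (hs : ∀ l, CartanMatrix.A r l k = 0 → Commute s (x l)) (h : CartanMatrix.A r i j = 0) :
    x i * (if j = k then s else 0) + (if i = k then s else 0) * x j =
      x j * (if i = k then s else 0) + (if j = k then s else 0) * x i := by
  have hij : i ≠ j := ne_of_cartan_ne_two (by omega)
  by_cases hi : i = k
  · subst hi
    simp [hij.symm, (hs j (cartan_comm j i ▸ h)).eq]
  by_cases hj : j = k
  · subst hj
    simp [hij, (hs i h).eq]
  · simp [hi, hj]

end Cartan

section PositivePart

noncomputable section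

variable {K : Type*} [Field K]

/-- The quantum Serre relations between the generators of the positive part. -/
inductive PosRel (r : ℕ) (q : K) : FreeAlgebra K (Fin r) → FreeAlgebra K (Fin r) → Prop
  | comm (i j : Fin r) (h : CartanMatrix.A r i j = 0) :
      PosRel r q (FreeAlgebra.ι K i * FreeAlgebra.ι K j) (FreeAlgebra.ι K j * FreeAlgebra.ι K i)
  | serre (i j : Fin r) (h : CartanMatrix.A r i j = -1) :
      PosRel r q (serreElt q (FreeAlgebra.ι K i) (FreeAlgebra.ι K j)) 0

/-- The algebra presented by the quantum Serre relations of type `A_r`, which plays the role of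
the positive part `U_q⁺`. -/
def UPos (r : ℕ) (q : K) : Type _ := RingQuot (PosRel r q)

instance (r : ℕ) (q : K) : Ring (UPos r q) := inferInstanceAs (Ring (RingQuot (PosRel r q)))

instance (r : ℕ) (q : K) : Algebra K (UPos r q) :=
  inferInstanceAs (Algebra K (RingQuot (PosRel r q)))

variable {r : ℕ} {q : K} {A : Type*} [Ring A] [Algebra K A]

variable (r q) in
/-- The quotient map from the free algebra onto the positive part. -/
def posMk : FreeAlgebra K (Fin r) →ₐ[K] UPos r q := RingQuot.mkAlgHom K (PosRel r q)

variable (q) in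
/-- The generator `E_i` of the positive part. -/
def posE (i : Fin r) : UPos r q := posMk r q (FreeAlgebra.ι K i)

theorem commute_posE {i j : Fin r} (h : CartanMatrix.A r i j = 0) :
    Commute (posE q i) (posE q j) := by
  have hrel : posMk r q _ = posMk r q _ := RingQuot.mkAlgHom_rel K (PosRel.comm i j h)
  rwa [map_mul, map_mul] at hrel

theorem serreElt_posE {i j : Fin r} (h : CartanMatrix.A r i j = -1) :
    serreElt q (posE q i) (posE q j) = 0 := by
  have hrel : posMk r q _ = posMk r q _ := RingQuot.mkAlgHom_rel K (PosRel.serre i j h)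
  rwa [map_serreElt, map_zero] at hrel

/-- The universal property of the positive part. -/
def posLift (f : Fin r → A) (hcomm : ∀ i j, CartanMatrix.A r i j = 0 → f i * f j = f j * f i)
    (hserre : ∀ i j, CartanMatrix.A r i j = -1 → serreElt q (f i) (f j) = 0) :
    UPos r q →ₐ[K] A :=
  RingQuot.liftAlgHom (S := K) (s := PosRel r q) ⟨FreeAlgebra.lift K f, fun a b h => by
    cases h with
    | comm i j h => simpa using hcomm i j h
    | serre i j h => simpa [map_serreElt] using hserre i j h⟩

@[simp]
theorem posLift_posE (f : Fin r → A) (hcomm)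
    (hserre : ∀ i j, CartanMatrix.A r i j = -1 → serreElt q (f i) (f j) = 0) (i : Fin r) :
    posLift f hcomm hserre (posE q i) = f i :=
  (RingQuot.liftAlgHom_mkAlgHom_apply K _ _ _).trans (FreeAlgebra.lift_ι_apply f i)

theorem posHom_ext {f g : UPos r q →ₐ[K] A} (h : ∀ i, f (posE q i) = g (posE q i)) : f = g :=
  RingQuot.ringQuot_ext' K _ _ (FreeAlgebra.hom_ext (funext h))

theorem span_closure_range_posE :
    Submodule.span K (Submonoid.closure (Set.range (posE (r := r) q)) : Set (UPos r q)) = ⊤ := by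
  have hrange : Set.range (posE (r := r) q) = posMk r q '' Set.range (FreeAlgebra.ι K) := by
    rw [← Set.range_comp]
    rfl
  have hsurj : (posMk r q).range = ⊤ :=
    (AlgHom.range_eq_top _).2 (RingQuot.mkAlgHom_surjective K _)
  rw [← Algebra.adjoin_eq_span, hrange, ← AlgHom.map_adjoin, FreeAlgebra.adjoin_range_ι,
    Algebra.map_top, hsurj, Algebra.top_toSubmodule]

/-- The endomorphism of the positive part which rescales the generators. -/
def posScale (χ : Fin r → K) : UPos r q →ₐ[K] UPos r q :=
  posLift (fun i => χ i • posE q i)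
    (fun i j h => by rw [smul_mul_smul_comm, smul_mul_smul_comm, commute_posE h, mul_comm])
    (fun i j h => by rw [serreElt_smul_smul, serreElt_posE h, smul_zero])

@[simp]
theorem posScale_posE (χ : Fin r → K) (i : Fin r) :
    posScale χ (posE q i) = χ i • posE q i := by
  rw [posScale, posLift_posE]

variable (q) in
/-- The action of `E_i` on the positive part, by left multiplication. -/
def opE (i : Fin r) : Module.End K (UPos r q) := Algebra.lmul K (UPos r q) (posE q i)

variable (q) in
/-- The action of `L_ζ` on the positive part, which fixes `1`. -/
def opL (ζ : WeightLattice r) : Module.End K (UPos r q) :=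
  (posScale fun i => q ^ ζ i).toLinearMap

variable (q) in
/-- The action of `E_i F_i - F_i E_i` on the positive part. -/
def opBracket (i : Fin r) : Module.End K (UPos r q) :=
  (q - q⁻¹)⁻¹ • (opL q (toWeight (simpleRoot i)) - opL q (-toWeight (simpleRoot i)))

@[simp]
theorem opE_apply (i : Fin r) (v : UPos r q) : opE q i v = posE q i * v := rfl

@[simp]
theorem opL_one (ζ : WeightLattice r) : opL q ζ 1 = 1 := map_one (posScale fun i => q ^ ζ i)

theorem opL_zero : opL q (0 : WeightLattice r) = 1 := by
  have hscale : posScale (fun i => q ^ (0 : WeightLattice r) i) = AlgHom.id K (UPos r q) :=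
    posHom_ext fun i => by simp
  rw [opL, hscale]
  rfl

theorem opL_mul_opL (hq : q ≠ 0) (ζ ξ : WeightLattice r) : opL q ζ * opL q ξ = opL q (ζ + ξ) := by
  have hscale : (posScale fun i => q ^ ζ i).comp (posScale fun i => q ^ ξ i) =
      posScale (q := q) fun i => q ^ (ζ + ξ) i :=
    posHom_ext fun i => by simp [zpow_add₀ hq, smul_smul, mul_comm]
  rw [opL, opL, opL, ← hscale]
  rfl

theorem commute_opL (hq : q ≠ 0) (ζ ξ : WeightLattice r) : Commute (opL q ζ) (opL q ξ) := by
  rw [Commute, SemiconjBy, opL_mul_opL hq, opL_mul_opL hq, add_comm]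

theorem qCommute_opL_opE (ζ : WeightLattice r) (i : Fin r) :
    QCommute (q ^ ζ i) (opL q ζ) (opE q i) := by
  ext v
  simp [opL]

theorem commute_opE {i j : Fin r} (h : CartanMatrix.A r i j = 0) :
    Commute (opE q i) (opE q j) :=
  (commute_posE h).map (Algebra.lmul K (UPos r q))

theorem serreElt_opE {i j : Fin r} (h : CartanMatrix.A r i j = -1) :
    serreElt q (opE q i) (opE q j) = 0 := by
  rw [opE, opE, ← map_serreElt, serreElt_posE h, map_zero]

theorem eq_zero_of_qCommute_opE {S : Module.End K (UPos r q)} (h1 : S 1 = 0)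
    (h : ∀ i, ∃ c : K, QCommute c S (opE q i)) : S = 0 := by
  refine LinearMap.ext_on span_closure_range_posE fun v hv => ?_
  induction hv using Submonoid.closure_induction_left with
  | one => exact h1
  | mul_left x hx y _ hy =>
    obtain ⟨i, rfl⟩ := hx
    obtain ⟨c, hc⟩ := h i
    have hSy : S (posE q i * y) = c • (posE q i * S y) := LinearMap.congr_fun hc y
    rw [hSy, hy, LinearMap.zero_apply, mul_zero, smul_zero, LinearMap.zero_apply]

theorem qCommute_opL_opE_of_cartan (i j : Fin r) :
    QCommute (q ^ CartanMatrix.A r j i) (opL q (toWeight (simpleRoot i))) (opE q j) := by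
  simpa only [toWeight_simpleRoot] using qCommute_opL_opE (q := q) (toWeight (simpleRoot i)) j

theorem qCommute_opL_neg_opE_of_cartan (i j : Fin r) :
    QCommute (q⁻¹ ^ CartanMatrix.A r j i) (opL q (-toWeight (simpleRoot i))) (opE q j) := by
  simpa only [Pi.neg_apply, toWeight_simpleRoot, zpow_neg, inv_zpow] using
    qCommute_opL_opE (q := q) (-toWeight (simpleRoot i)) j

theorem commute_opBracket_opE {i j : Fin r} (h : CartanMatrix.A r j i = 0) :
    Commute (opBracket q i) (opE q j) := by
  have hpos := qCommute_opL_opE_of_cartan (q := q) i j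
  have hneg := qCommute_opL_neg_opE_of_cartan (q := q) i j
  rw [h, zpow_zero] at hpos hneg
  exact (hpos.commute.sub_left hneg.commute).smul_left _

section DualNumber

open TrivSqZeroExt

/-- The representation of the positive part on `Module.End K (UPos r q)[ε]` whose `ε`-component is
the derivation `v ↦ F_k v - v F_k` along left multiplication: on the generator `E_j` it is
`-δ_{jk} (E_k F_k - F_k E_k)`. -/
def commutatorHom (hq : q ≠ 0) (k : Fin r) :
    UPos r q →ₐ[K] DualNumber (Module.End K (UPos r q)) :=
  posLift (fun j => inl (opE q j) + inr (if j = k then -opBracket q k else 0))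
    (fun i j h => by
      have hsnd := mul_single_add_single_mul_comm (x := opE q)
        (s := -opBracket q k) (k := k) (fun l hl => (commute_opBracket_opE (q := q) hl).neg_left) h
      rw [inl_add_inr_mul_inl_add_inr, inl_add_inr_mul_inl_add_inr, hsnd, (commute_opE h).eq])
    (fun i j h => by
      have hsnd := serreDeriv_single_smul_sub_eq_zero (x := opE q) hq rfl
        (qCommute_opL_opE_of_cartan k) (qCommute_opL_neg_opE_of_cartan k) (-(q - q⁻¹)⁻¹) h
      rw [neg_smul] at hsnd
      rw [serreElt_inl_add_inr, serreElt_opE h, opBracket, hsnd, inl_zero, inr_zero, add_zero])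

theorem commutatorHom_posE (hq : q ≠ 0) (k j : Fin r) :
    commutatorHom hq k (posE q j) =
      inl (opE q j) + inr (if j = k then -opBracket q k else 0) :=
  posLift_posE _ _ _ _

theorem fst_commutatorHom (hq : q ≠ 0) (k : Fin r) (v : UPos r q) :
    fst (commutatorHom hq k v) = Algebra.lmul K (UPos r q) v := by
  have hfst : (fstHom K _ _).comp (commutatorHom hq k) = Algebra.lmul K (UPos r q) :=
    posHom_ext fun i => by
      rw [AlgHom.comp_apply, commutatorHom_posE]
      rw [map_add, fstHom_apply, fstHom_apply, fst_inl, fst_inr, add_zero, opE]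
  exact DFunLike.congr_fun hfst v

/-- The action of `F_k` on the positive part: `F_k v` is the commutator of `F_k` and `v` applied to
the lowest weight vector `1`. -/
def opF (hq : q ≠ 0) (k : Fin r) : Module.End K (UPos r q) :=
  LinearMap.applyₗ (1 : UPos r q) ∘ₗ
    sndHom (Module.End K (UPos r q)) (Module.End K (UPos r q)) ∘ₗ (commutatorHom hq k).toLinearMap

theorem opF_apply (hq : q ≠ 0) (k : Fin r) (v : UPos r q) :
    opF hq k v = snd (commutatorHom hq k v) 1 := rfl

theorem opF_one (hq : q ≠ 0) (k : Fin r) : opF hq k 1 = 0 := by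
  rw [opF_apply, map_one (commutatorHom hq k), snd_one, LinearMap.zero_apply]

theorem opF_mul_opE (hq : q ≠ 0) (k j : Fin r) :
    opF hq k * opE q j = opE q j * opF hq k - if j = k then opBracket q k else 0 := by
  have hsingle : (if j = k then -opBracket q k else 0) = -if j = k then opBracket q k else 0 := by
    split_ifs <;> simp
  ext v
  rw [Module.End.mul_apply, opE_apply, opF_apply, map_mul, commutatorHom_posE, snd_mul,
    fst_commutatorHom, hsingle]
  split_ifs <;> simp [opF_apply, sub_eq_add_neg]

end DualNumber

theorem opF_mul_opE_sub_opE_mul_opF (hq : q ≠ 0) (k j : Fin r) :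
    opF hq k * opE q j - opE q j * opF hq k = if k = j then -opBracket q j else 0 := by
  rw [opF_mul_opE, sub_sub_cancel_left]
  by_cases h : k = j
  · rw [if_pos h, if_pos h.symm, h]
  · rw [if_neg h, if_neg (Ne.symm h), neg_zero]

theorem commute_opL_opBracket (hq : q ≠ 0) (ζ : WeightLattice r) (k : Fin r) :
    Commute (opL q ζ) (opBracket q k) :=
  ((commute_opL hq ζ _).sub_right (commute_opL hq ζ _)).smul_right _

theorem qCommute_opL_opF (hq : q ≠ 0) (ζ : WeightLattice r) (k : Fin r) :
    QCommute (q ^ (-ζ k)) (opL q ζ) (opF hq k) := by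
  rw [QCommute, ← sub_eq_zero]
  refine eq_zero_of_qCommute_opE (by simp [opF_one]) fun j => ⟨q ^ ζ j, ?_⟩
  have hLE : opL q ζ * opE q j = q ^ ζ j • (opE q j * opL q ζ) := qCommute_opL_opE ζ j
  have hFE := opF_mul_opE hq k j
  have hLFE : opL q ζ * opF hq k * opE q j = q ^ ζ j • (opE q j * (opL q ζ * opF hq k)) -
      opL q ζ * if j = k then opBracket q k else 0 := by
    rw [mul_assoc, hFE, mul_sub, ← mul_assoc, hLE, smul_mul_assoc, mul_assoc]
  have hFLE : opF hq k * opL q ζ * opE q j = q ^ ζ j • (opE q j * (opF hq k * opL q ζ) -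
      (if j = k then opBracket q k else 0) * opL q ζ) := by
    rw [mul_assoc, hLE, mul_smul_comm, ← mul_assoc, hFE, sub_mul, mul_assoc]
  rw [QCommute, sub_mul, smul_mul_assoc, hLFE, hFLE]
  split_ifs with hjk
  · subst hjk
    have hz : q ^ ζ j ≠ 0 := zpow_ne_zero _ hq
    rw [(commute_opL_opBracket hq ζ j).eq, zpow_neg, inv_smul_smul₀ hz, mul_sub, mul_smul_comm]
    simp only [smul_sub, smul_inv_smul₀ hz]
    abel
  · simp only [mul_zero, zero_mul, sub_zero, mul_sub, mul_smul_comm, smul_sub]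
    rw [smul_comm]

theorem qCommute_opL_opF_of_cartan (hq : q ≠ 0) (i j : Fin r) :
    QCommute (q⁻¹ ^ CartanMatrix.A r j i) (opL q (toWeight (simpleRoot i))) (opF hq j) := by
  simpa only [toWeight_simpleRoot, zpow_neg, inv_zpow] using
    qCommute_opL_opF hq (toWeight (simpleRoot i)) j

theorem qCommute_opL_neg_opF_of_cartan (hq : q ≠ 0) (i j : Fin r) :
    QCommute (q⁻¹⁻¹ ^ CartanMatrix.A r j i) (opL q (-toWeight (simpleRoot i))) (opF hq j) := by
  simpa only [Pi.neg_apply, neg_neg, toWeight_simpleRoot, inv_inv] using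
    qCommute_opL_opF hq (-toWeight (simpleRoot i)) j

theorem commute_opBracket_opF (hq : q ≠ 0) {i j : Fin r} (h : CartanMatrix.A r j i = 0) :
    Commute (opBracket q i) (opF hq j) := by
  have hpos := qCommute_opL_opF_of_cartan hq i j
  have hneg := qCommute_opL_neg_opF_of_cartan hq i j
  rw [h, zpow_zero] at hpos hneg
  exact (hpos.commute.sub_left hneg.commute).smul_left _

theorem commute_opF (hq : q ≠ 0) {i j : Fin r} (h : CartanMatrix.A r i j = 0) :
    Commute (opF hq i) (opF hq j) := by
  rw [Commute, SemiconjBy, ← sub_eq_zero]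
  refine eq_zero_of_qCommute_opE (by simp [opF_one]) fun k => ⟨1, .of_commute ?_⟩
  have hcomm := mul_single_add_single_mul_comm (x := opF hq) (s := -opBracket q k) (k := k)
    (fun l hl => (commute_opBracket_opF hq hl).neg_left) h
  simp only [← opF_mul_opE_sub_opE_mul_opF hq] at hcomm
  rw [← sub_eq_zero] at hcomm
  rw [Commute, SemiconjBy, ← sub_eq_zero, ← hcomm]
  simp only [mul_sub, sub_mul, mul_assoc]
  abel

theorem serreElt_opF (hq : q ≠ 0) {i j : Fin r} (h : CartanMatrix.A r i j = -1) :
    serreElt q (opF hq i) (opF hq j) = 0 := by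
  refine eq_zero_of_qCommute_opE (by simp [serreElt, opF_one, pow_two]) fun k =>
    ⟨1, .of_commute ?_⟩
  have hserre := serreDeriv_single_smul_sub_eq_zero (q := q) (x := opF hq) (inv_ne_zero hq)
    (by rw [inv_inv, add_comm]) (qCommute_opL_opF_of_cartan hq k)
    (qCommute_opL_neg_opF_of_cartan hq k) (-(q - q⁻¹)⁻¹) h
  rw [neg_smul, ← opBracket, ← opF_mul_opE_sub_opE_mul_opF hq,
    ← opF_mul_opE_sub_opE_mul_opF hq, ← serreElt_mul_sub_mul_serreElt, sub_eq_zero] at hserre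
  exact hserre

end

noncomputable section

variable {r : ℕ} {q : ℂ}

/-- The action of the quantized enveloping algebra on its positive part, as the Verma module with
lowest weight `0`. -/
def vermaRep (hq : q ≠ 0) : Uq r q →ₐ[ℂ] Module.End ℂ (UPos r q) :=
  RingQuot.liftAlgHom ℂ ⟨FreeAlgebra.lift ℂ fun g => match g with
    | Gen.E i => opE q i
    | Gen.F i => opF hq i
    | Gen.L ζ => opL q ζ, fun a b h => by
    cases h with
    | L_zero => simpa using opL_zero
    | L_add ζ ξ => simpa using opL_mul_opL hq ζ ξ
    | L_E ζ i => simpa [pairing_simpleRoot, QCommute] using qCommute_opL_opE ζ i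
    | L_F ζ i => simpa [pairing_simpleRoot, QCommute] using qCommute_opL_opF hq ζ i
    | E_F_self i => simp [opF_mul_opE, opBracket]
    | E_F_ne i j h => simp [opF_mul_opE, h]
    | E_comm i j h => simpa using (commute_opE h).eq
    | F_comm i j h => simpa using (commute_opF hq h).eq
    | E_serre i j h => simpa [serreElt] using serreElt_opE (q := q) h
    | F_serre i j h => simpa [serreElt] using serreElt_opF hq h⟩

theorem vermaRep_E (hq : q ≠ 0) (i : Fin r) : vermaRep hq (E q i) = opE q i := by
  simp [vermaRep, E]

theorem vermaRep_L (hq : q ≠ 0) (ζ : WeightLattice r) : vermaRep hq (L q ζ) = opL q ζ := by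
  simp [vermaRep, L]

end

end PositivePart

/-! ### Sums of Serre families -/

section SerreSum

variable {K A : Type*} [Field K] [Ring A] [Algebra K A] {q : K}

theorem QCommute.symm {c : K} {a b : A} (hc : c ≠ 0) (h : QCommute c a b) : QCommute c⁻¹ b a := by
  rw [QCommute, h, inv_smul_smul₀ hc]

theorem QCommute.sum_left {ι : Type*} {s : Finset ι} {f : ι → A} {c : K} {x : A}
    (h : ∀ k ∈ s, QCommute c (f k) x) : QCommute c (∑ k ∈ s, f k) x := by
  rw [QCommute, Finset.sum_mul, Finset.mul_sum, Finset.smul_sum]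
  exact Finset.sum_congr rfl h

theorem QCommute.mul_eq {c : K} {a b : A} (h : QCommute c a b) : a * b = c • (b * a) := h

theorem QCommute.mul_mul {c : K} {x y : A} (h : QCommute c x y) (z : A) :
    x * (y * z) = c • (y * (x * z)) := by
  rw [← mul_assoc, h, smul_mul_assoc, mul_assoc]

theorem QCommute.serreElt_eq_zero (hq : q ≠ 0) {x y : A} (h : QCommute q x y) :
    serreElt q x y = 0 := by
  simp only [serreElt, pow_two, mul_assoc, h.mul_eq, h.mul_mul, smul_mul_assoc, mul_smul_comm]
  match_scalars
  field_simp
  ring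

theorem QCommute.serreElt_eq_zero_of_right (hq : q ≠ 0) {x y : A} (h : QCommute q y x) :
    serreElt q x y = 0 := by
  simp only [serreElt, pow_two, mul_assoc, h.mul_eq, h.mul_mul, mul_smul_comm]
  match_scalars
  field_simp
  ring

theorem serreElt_add (hq : q ≠ 0) {a₁ a₂ b₁ b₂ : A} (h₁₁ : QCommute (q⁻¹ ^ 2) a₁ b₁)
    (h₁₂ : QCommute q a₁ b₂) (h₂₁ : QCommute q a₂ b₁) :
    serreElt q (a₁ + b₁) (a₂ + b₂) = serreElt q a₁ a₂ + serreElt q b₁ b₂ := by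
  rw [← sub_eq_zero]
  simp only [serreElt, pow_two (_ + _), pow_two a₁, pow_two b₁, mul_add, add_mul, mul_assoc,
    h₁₁.mul_eq, h₁₁.mul_mul, h₁₂.mul_eq, h₁₂.mul_mul, h₂₁.mul_eq, h₂₁.mul_mul,
    smul_mul_assoc, mul_smul_comm]
  match_scalars <;> field_simp <;> ring

theorem isSerreFamily_zero : IsSerreFamily q (0 : ℤ → A) :=
  ⟨fun _ => Commute.zero_left _, fun _ => by simp [serreElt]⟩

end SerreSum

/-! ### A Feigin homomorphism to a quantum torus -/

section TorusFamily

variable {K A : Type*} [Field K] [Ring A] [Algebra K A] {q : K} {y : ℤ → ℕ → A} {c : ℤ → ℕ}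
  {i j l n : ℕ}

/-- The order of the variables of the quantum torus, which are numbered by a node and a colour:
first by colour, then by the distance of the node from the middle node. -/
def Earlier (p r : ℤ × ℕ) : Prop := p.2 < r.2 ∨ p.2 = r.2 ∧ p.1.natAbs < r.1.natAbs

/-- Elements numbered by the nodes of the diagram `A_∞` and by colours, with the commutation
relations of a quantum torus, or with some of the elements replaced by zero. -/
structure IsTorusFamily (q : K) (y : ℤ → ℕ → A) : Prop where
  commute : ∀ {i j : ℤ} (k l : ℕ), i + 1 < j ∨ j + 1 < i → Commute (y i k) (y j l)
  adjacent : ∀ {i j : ℤ} {k l : ℕ}, i + 1 = j ∨ j + 1 = i → Earlier (i, k) (j, l) →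
    QCommute q (y i k) (y j l)
  same : ∀ (i : ℤ) {k l : ℕ}, k < l → QCommute (q⁻¹ ^ 2) (y i k) (y i l)

/-- The sum of the elements of colour less than `n` at a node. -/
def colourSum (y : ℤ → ℕ → A) (n : ℕ) (i : ℤ) : A := ∑ k ∈ Finset.range n, y i k

theorem IsTorusFamily.isSerreFamily (hy : IsTorusFamily q y) (hq : q ≠ 0) (k : ℕ) :
    IsSerreFamily q fun i => y i k where
  commute h := hy.commute k k h
  serre_eq_zero {i j} h := by
    rcases lt_or_gt_of_ne (by omega : i.natAbs ≠ j.natAbs) with hij | hji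
    · exact (hy.adjacent h (.inr ⟨rfl, hij⟩)).serreElt_eq_zero hq
    · exact (hy.adjacent h.symm (.inr ⟨rfl, hji⟩)).serreElt_eq_zero_of_right hq

theorem IsTorusFamily.isSerreFamily_colourSum (hy : IsTorusFamily q y) (hq : q ≠ 0) (n : ℕ) :
    IsSerreFamily q (colourSum y n) := by
  induction n with
  | zero => exact isSerreFamily_zero
  | succ n ih =>
    refine ⟨fun h => ?_, fun {i j} h => ?_⟩
    · exact Commute.sum_left _ _ _ fun k _ => Commute.sum_right _ _ _ fun l _ => hy.commute k l h
    have adjacent {i j : ℤ} (h : i + 1 = j ∨ j + 1 = i) : QCommute q (colourSum y n i) (y j n) :=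
      .sum_left fun k hk => hy.adjacent h (.inl (Finset.mem_range.1 hk))
    have same : QCommute (q⁻¹ ^ 2) (colourSum y n i) (y i n) :=
      .sum_left fun k hk => hy.same i (Finset.mem_range.1 hk)
    have hsucc (i : ℤ) : colourSum y (n + 1) i = colourSum y n i + y i n :=
      Finset.sum_range_succ _ _
    rw [hsucc, hsucc, serreElt_add hq same (adjacent h) (adjacent h.symm), ih.serre_eq_zero h,
      (hy.isSerreFamily hq n).serre_eq_zero h, add_zero]

/-- The monomial with one factor of colour `c t` at each node `t` of the interval `[-i, j]`, in the
order in which the root vectors enter `grid`. -/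
def hook (y : ℤ → ℕ → A) (c : ℤ → ℕ) : ℕ → ℕ → A
  | 0, 0 => y 0 (c 0)
  | 0, j + 1 => y (j + 1) (c (j + 1)) * hook y c 0 j
  | i + 1, j => y (-(i + 1)) (c (-(i + 1))) * hook y c i j

theorem hook_zero : hook y c 0 0 = y 0 (c 0) := by rw [hook]

theorem hook_zero_succ (j : ℕ) :
    hook y c 0 (j + 1) = y (j + 1) (c (j + 1)) * hook y c 0 j := by rw [hook]

theorem hook_succ (i j : ℕ) :
    hook y c (i + 1) j = y (-(i + 1)) (c (-(i + 1))) * hook y c i j := by rw [hook]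

theorem hook_congr {c' : ℤ → ℕ} (h : ∀ t ∈ Set.Icc (-i : ℤ) j, c t = c' t) :
    hook y c i j = hook y c' i j := by
  induction i with
  | zero =>
    induction j with
    | zero => rw [hook_zero, hook_zero, h 0 (by simp)]
    | succ j ih =>
      rw [hook_zero_succ, hook_zero_succ, h _ (by constructor <;> push_cast <;> omega),
        ih fun t ht => h t ⟨ht.1, ht.2.trans (by push_cast; omega)⟩]
  | succ i ih =>
    rw [hook_succ, hook_succ, h _ (by constructor <;> push_cast <;> omega),
      ih fun t ht => h t ⟨le_trans (by push_cast; omega) ht.1, ht.2⟩]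

theorem hook_eq_zero {t : ℤ} (ht : t ∈ Set.Icc (-i : ℤ) j) (h : y t (c t) = 0) :
    hook y c i j = 0 := by
  obtain ⟨hit, htj⟩ := ht
  induction i with
  | zero =>
    induction j with
    | zero => rw [hook_zero, ← h, show t = 0 by omega]
    | succ j ih =>
      rw [hook_zero_succ]
      rcases eq_or_ne t (j + 1) with rfl | hne
      · rw [h, zero_mul]
      · rw [ih (by omega), mul_zero]
  | succ i ih =>
    rw [hook_succ]
    rcases eq_or_ne t (-(i + 1)) with rfl | hne
    · rw [h, zero_mul]
    · rw [ih (by omega), mul_zero]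

namespace IsTorusFamily

theorem qCommute_outward (hy : IsTorusFamily q y) (hq : q ≠ 0) {s t : ℤ}
    (h : s + 1 = t ∨ t + 1 = s) (hst : s.natAbs < t.natAbs) (k l : ℕ) :
    QCommute (if l < k then q else q⁻¹) (y t l) (y s k) := by
  split_ifs with hlk
  · exact hy.adjacent h.symm (.inl hlk)
  · exact (hy.adjacent h (by unfold Earlier; simp only; omega)).symm hq

theorem commute_hook_row (hy : IsTorusFamily q y) {t : ℤ} (l : ℕ) (h : t < -1 ∨ j + 1 < t) :
    Commute (y t l) (hook y c 0 j) := by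
  induction j with
  | zero =>
    rw [hook_zero]
    exact hy.commute _ _ (by omega)
  | succ j ih =>
    rw [hook_zero_succ]
    exact (hy.commute _ _ (by omega)).mul_right (ih (by omega))

theorem commute_hook (hy : IsTorusFamily q y) {t : ℤ} (j l : ℕ) (h : t < -(i + 1)) :
    Commute (y t l) (hook y c i j) := by
  induction i with
  | zero => exact hy.commute_hook_row l (by omega)
  | succ i ih =>
    rw [hook_succ]
    exact (hy.commute _ _ (by omega)).mul_right (ih (by omega))

theorem qCommute_hook_right (hy : IsTorusFamily q y) (hq : q ≠ 0) (c : ℤ → ℕ) (j l : ℕ) :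
    QCommute (if l < c j then q else q⁻¹) (y (j + 1) l) (hook y c 0 j) := by
  cases j with
  | zero =>
    rw [hook_zero]
    exact hy.qCommute_outward hq (by simp) (by simp) _ _
  | succ j =>
    have hnext := hy.qCommute_outward hq (s := j + 1) (t := j + 1 + 1) (by simp) (by omega)
      (c (j + 1)) l
    have hrest : Commute (y (j + 1 + 1) l) (hook y c 0 j) := hy.commute_hook_row l (by omega)
    rw [hook_zero_succ]
    simpa using hnext.mul_right (.of_commute hrest)

theorem qCommute_hook_row_left (hy : IsTorusFamily q y) (hq : q ≠ 0) (c : ℤ → ℕ) (j l : ℕ) :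
    QCommute (if l < c 0 then q else q⁻¹) (y (-1) l) (hook y c 0 j) := by
  induction j with
  | zero =>
    rw [hook_zero]
    exact hy.qCommute_outward hq (by simp) (by simp) _ _
  | succ j ih =>
    have hlast : Commute (y (-1) l) (y (j + 1) (c (j + 1))) := hy.commute _ _ (by omega)
    have h := (QCommute.of_commute (K := K) hlast).mul_right ih
    rwa [one_mul, ← hook_zero_succ] at h

theorem qCommute_hook_left (hy : IsTorusFamily q y) (hq : q ≠ 0) (c : ℤ → ℕ) (i j l : ℕ) :
    QCommute (if l < c (-i) then q else q⁻¹) (y (-(i + 1)) l) (hook y c i j) := by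
  cases i with
  | zero => simpa using hy.qCommute_hook_row_left hq c j l
  | succ i =>
    have hnext := hy.qCommute_outward hq (s := -(i + 1)) (t := -(i + 1 + 1)) (by omega) (by omega)
      (c (-(i + 1))) l
    have hrest : Commute (y (-(i + 1 + 1)) l) (hook y c i j) := hy.commute_hook j l (by omega)
    rw [hook_succ]
    simpa using hnext.mul_right (.of_commute hrest)

end IsTorusFamily

/-- Colourings of the nodes whose colours weakly increase outwards from the middle node. -/
def IsVShaped (c : ℤ → ℕ) : Prop := AntitoneOn c (Set.Iic 0) ∧ MonotoneOn c (Set.Ici 0)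

theorem isVShaped_const (k : ℕ) : IsVShaped fun _ => k :=
  ⟨antitoneOn_const, monotoneOn_const⟩

/-- The span of the hooks with a non-constant V-shaped colouring. In the quantum torus these are
the terms of a grid vector which are lower than its leading term. -/
def hookSpan (K : Type*) {A : Type*} [Field K] [Ring A] [Algebra K A] (y : ℤ → ℕ → A) (i j : ℕ) :
    Submodule K A :=
  Submodule.span K {T | ∃ c, IsVShaped c ∧ (∃ t ∈ Set.Icc (-i : ℤ) j, c 0 < c t) ∧
    T = hook y c i j}

theorem mul_hook_mem_hookSpan_left (hc : IsVShaped c) (hl : c (-i) ≤ l)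
    (hlt : c 0 < l ∨ ∃ t ∈ Set.Icc (-i : ℤ) j, c 0 < c t) :
    y (-(i + 1)) l * hook y c i j ∈ hookSpan K y (i + 1) j := by
  let c' : ℤ → ℕ := fun t => if t < -i then l else c t
  have hnew : c' (-(i + 1)) = l := if_pos (by omega)
  have hold {t : ℤ} (ht : -i ≤ t) : c' t = c t := if_neg (by omega)
  refine Submodule.subset_span ⟨c', ⟨fun s hs t ht hst => ?_, fun s hs t ht hst => ?_⟩, ?_, ?_⟩
  · rcases lt_or_ge s (-i) with hsi | hsi
    · rw [show c' s = l from if_pos hsi]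
      rcases lt_or_ge t (-i) with hti | hti
      · exact (if_pos hti).le
      · rw [hold hti]
        exact (hc.1 (by simp) ht hti).trans hl
    · rw [hold hsi, hold (hsi.trans hst)]
      exact hc.1 hs ht hst
  · rw [Set.mem_Ici] at hs ht
    rw [hold (by omega), hold (by omega)]
    exact hc.2 hs ht hst
  · rw [hold (by omega)]
    rcases hlt with hlt | ⟨t, ht, hlt⟩
    · exact ⟨-(i + 1), by constructor <;> push_cast <;> omega, by rwa [hnew]⟩
    · exact ⟨t, ⟨le_trans (by push_cast; omega) ht.1, ht.2⟩, by rwa [hold ht.1]⟩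
  · rw [hook_succ, hnew, hook_congr fun t ht => hold ht.1]

theorem mul_hook_mem_hookSpan_right (hc : IsVShaped c) (hl : c j ≤ l)
    (hlt : c 0 < l ∨ ∃ t ∈ Set.Icc (-(0 : ℕ) : ℤ) j, c 0 < c t) :
    y (j + 1) l * hook y c 0 j ∈ hookSpan K y 0 (j + 1) := by
  let c' : ℤ → ℕ := fun t => if j < t then l else c t
  have hnew : c' (j + 1) = l := if_pos (by omega)
  have hold {t : ℤ} (ht : t ≤ j) : c' t = c t := if_neg (by omega)
  refine Submodule.subset_span ⟨c', ⟨fun s hs t ht hst => ?_, fun s hs t ht hst => ?_⟩, ?_, ?_⟩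
  · rw [Set.mem_Iic] at hs ht
    rw [hold (by omega), hold (by omega)]
    exact hc.1 hs ht hst
  · rcases lt_or_ge (j : ℤ) t with hjt | hjt
    · rw [show c' t = l from if_pos hjt]
      rcases lt_or_ge (j : ℤ) s with hjs | hjs
      · exact (if_pos hjs).le
      · rw [hold hjs]
        exact (hc.2 hs (by simp) hjs).trans hl
    · rw [hold hjt, hold (hst.trans hjt)]
      exact hc.2 hs ht hst
  · rw [hold (by omega)]
    rcases hlt with hlt | ⟨t, ht, hlt⟩
    · exact ⟨j + 1, by constructor <;> push_cast <;> omega, by rwa [hnew]⟩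
    · exact ⟨t, ⟨ht.1, ht.2.trans (by push_cast; omega)⟩, by rwa [hold ht.2]⟩
  · rw [hook_zero_succ, hnew, hook_congr fun t ht => hold ht.2]

/-- `qComm` as a linear map in its second argument. -/
def qCommHom (q : K) (a : A) : A →ₗ[K] A := LinearMap.mulLeft K a - q • LinearMap.mulRight K a

theorem qCommHom_apply (q : K) (a x : A) : qCommHom q a x = qComm q a x := by
  simp [qCommHom, qComm]

theorem qComm_sum_left {ι : Type*} (s : Finset ι) (f : ι → A) (x : A) :
    qComm q (∑ i ∈ s, f i) x = ∑ i ∈ s, qComm q (f i) x := by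
  simp only [qComm, Finset.sum_mul, Finset.mul_sum, Finset.smul_sum, Finset.sum_sub_distrib]

theorem QCommute.qComm_eq_ite (hq : q ≠ 0) {p : Prop} [Decidable p] {a x : A}
    (h : QCommute (if p then q else q⁻¹) a x) :
    qComm q a x = if p then 0 else (1 - q ^ 2) • (a * x) := by
  split_ifs at h ⊢
  · rw [qComm, h.mul_eq, sub_self]
  · rw [qComm, (h.symm (inv_ne_zero hq)).mul_eq, inv_inv]
    module

/-- One step of the recursion of `grid`: `x` lists the elements at the node which is added to the
interval `[-i, j]`, and `s` is the neighbouring end of this interval. Only the colours not less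
than the colour at `s` contribute, and the least such colour for a constant hook is its own. -/
theorem qComm_sum_sub_mem (hq : q ≠ 0) {x : ℕ → A} {s : ℤ} {W : Submodule K A} {g : A} {r : K}
    (hx : ∀ c l, QCommute (if l < c s then q else q⁻¹) (x l) (hook y c i j))
    (hmem : ∀ {c l}, IsVShaped c → c s ≤ l →
      (c 0 < l ∨ ∃ t ∈ Set.Icc (-i : ℤ) j, c 0 < c t) → x l * hook y c i j ∈ W)
    (hg : g - r • ∑ k ∈ Finset.range n, hook y (fun _ => k) i j ∈ hookSpan K y i j) :
    qComm q (∑ l ∈ Finset.range n, x l) g -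
      (r * (1 - q ^ 2)) • ∑ k ∈ Finset.range n, x k * hook y (fun _ => k) i j ∈ W := by
  have hterm (c : ℤ → ℕ) (l : ℕ) : qComm q (x l) (hook y c i j) =
      if l < c s then 0 else (1 - q ^ 2) • (x l * hook y c i j) := (hx c l).qComm_eq_ite hq
  have hlower : hookSpan K y i j ≤ W.comap (qCommHom q (∑ l ∈ Finset.range n, x l)) := by
    refine Submodule.span_le.2 ?_
    rintro _ ⟨c, hc, hlt, rfl⟩
    rw [SetLike.mem_coe, Submodule.mem_comap, qCommHom_apply, qComm_sum_left]
    refine W.sum_mem fun l _ => ?_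
    rw [hterm]
    split_ifs with hl
    · exact W.zero_mem
    · exact W.smul_mem _ (hmem hc (not_lt.1 hl) (.inr hlt))
  have hconst : ∀ k ∈ Finset.range n, qComm q (∑ l ∈ Finset.range n, x l)
      (hook y (fun _ => k) i j) - (1 - q ^ 2) • (x k * hook y (fun _ => k) i j) ∈ W := by
    intro k hk
    rw [qComm_sum_left, ← Finset.add_sum_erase _ _ hk, hterm, if_neg (lt_irrefl k),
      add_sub_cancel_left]
    refine W.sum_mem fun l hl => ?_
    rw [hterm]
    split_ifs with hlk
    · exact W.zero_mem
    · have hkl : k < l := lt_of_le_of_ne (not_lt.1 hlk) (Finset.ne_of_mem_erase hl).symm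
      exact W.smul_mem _ (hmem (isVShaped_const k) hkl.le (.inl hkl))
  have h := W.add_mem (hlower hg) (W.smul_mem r (W.sum_mem hconst))
  simp only [map_sub, map_smul, map_sum, qCommHom_apply, Finset.sum_sub_distrib,
    ← Finset.smul_sum] at h
  convert h using 1
  module

theorem IsTorusFamily.grid_sub_mem_hookSpan (hy : IsTorusFamily q y) (hq : q ≠ 0) (n i j : ℕ) :
    grid q (colourSum y n) i j -
      (1 - q ^ 2) ^ (i + j) • ∑ k ∈ Finset.range n, hook y (fun _ => k) i j ∈ hookSpan K y i j := by
  induction i with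
  | zero =>
    induction j with
    | zero => simp [grid_zero, hook_zero, colourSum]
    | succ j ih =>
      simp only [grid, hook_zero_succ, ← add_assoc, pow_succ (1 - q ^ 2)]
      exact qComm_sum_sub_mem hq (hy.qCommute_hook_right hq · j) mul_hook_mem_hookSpan_right ih
  | succ i ih =>
    simp only [grid_succ_left, hook_succ, add_right_comm i 1 j, pow_succ (1 - q ^ 2)]
    exact qComm_sum_sub_mem hq (hy.qCommute_hook_left hq · i j) mul_hook_mem_hookSpan_left ih

end TorusFamily

/-! ### The lexicographic numbering -/

section LexVar

variable {A : Type*} [Zero A] {n : ℕ}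

/-- The elements numbered by pairs, renumbered by `0, …, n * n - 1` in the lexicographic order, and
continued by zero. -/
def lexVar (f : Fin n × Fin n → A) (l : ℕ) : A :=
  if h : l < n * n then f (finProdFinEquiv.symm ⟨l, h⟩) else 0

theorem lexVar_of_lt (f : Fin n × Fin n → A) {l : ℕ} (h : l < n * n) :
    lexVar f l = f (finProdFinEquiv.symm ⟨l, h⟩) :=
  dif_pos h

theorem lexVar_coe (f : Fin n × Fin n → A) (l : Fin (n * n)) :
    lexVar f l = f (finProdFinEquiv.symm l) :=
  lexVar_of_lt f l.2

end LexVar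

/-! ### Leading terms -/

section LeadingTerms

variable {K M Γ : Type*} [Field K] [AddCommMonoid M] [AddCommMonoid Γ] [LinearOrder Γ]
  {w : M →+ Γ} {m m' : M} {d d' : Γ}
  {S T : Module.End K (M →₀ K)}

/-- The span of the monomials of weight less than `d`. -/
def weightLT (K : Type*) {M Γ : Type*} [Field K] [AddCommMonoid M] [AddCommMonoid Γ] [LT Γ]
    (w : M →+ Γ) (d : Γ) : Submodule K (M →₀ K) :=
  Finsupp.supported K K {h | w h < d}

/-- `T` multiplies every monomial by terms of weight less than `d`. -/
def IsLower (w : M →+ Γ) (d : Γ) (T : Module.End K (M →₀ K)) : Prop :=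
  ∀ h, T (Finsupp.single h 1) ∈ weightLT K w (w h + d)

/-- `T` multiplies every monomial by a non-zero multiple of the monomial `m`, up to terms of lower
weight; the multiple may depend on the monomial to which `T` is applied. -/
def HasLeading (w : M →+ Γ) (m : M) (T : Module.End K (M →₀ K)) : Prop :=
  ∀ h, ∃ s : K, s ≠ 0 ∧
    T (Finsupp.single h 1) - s • Finsupp.single (h + m) 1 ∈ weightLT K w (w h + w m)

theorem single_mem_weightLT (hd : w m < d) : Finsupp.single m 1 ∈ weightLT K w d :=
  Finsupp.single_mem_supported K _ hd

theorem weightLT_mono (h : d ≤ d') : weightLT K w d ≤ weightLT K w d' :=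
  Finsupp.supported_mono fun _ hx => lt_of_lt_of_le hx h

theorem isLower_zero : IsLower w d (0 : Module.End K (M →₀ K)) := fun _ => Submodule.zero_mem _

theorem IsLower.add (hS : IsLower w d S) (hT : IsLower w d T) : IsLower w d (S + T) :=
  fun h => Submodule.add_mem _ (hS h) (hT h)

theorem IsLower.smul (c : K) (hT : IsLower w d T) : IsLower w d (c • T) :=
  fun h => Submodule.smul_mem _ c (hT h)

theorem IsLower.sum {ι : Type*} {s : Finset ι} {f : ι → Module.End K (M →₀ K)}
    (h : ∀ i ∈ s, IsLower w d (f i)) : IsLower w d (∑ i ∈ s, f i) :=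
  Finset.sum_induction _ _ (fun _ _ => IsLower.add) isLower_zero h

theorem HasLeading.add_isLower (hS : HasLeading w m S) (hT : IsLower w (w m) T) :
    HasLeading w m (S + T) := by
  intro h
  obtain ⟨s, hs, hmem⟩ := hS h
  refine ⟨s, hs, ?_⟩
  rw [LinearMap.add_apply, add_sub_right_comm]
  exact Submodule.add_mem _ hmem (hT h)

theorem HasLeading.smul {c : K} (hc : c ≠ 0) (hT : HasLeading w m T) : HasLeading w m (c • T) := by
  intro h
  obtain ⟨s, hs, hmem⟩ := hT h
  refine ⟨c * s, mul_ne_zero hc hs, ?_⟩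
  rw [LinearMap.smul_apply, mul_smul, ← smul_sub]
  exact Submodule.smul_mem _ _ hmem

theorem hasLeading_one : HasLeading w 0 (1 : Module.End K (M →₀ K)) :=
  fun _ => ⟨1, one_ne_zero, by simp⟩

theorem linearIndependent_of_hasLeading {ι : Type*} {m : ι → M} (hm : Function.Injective m)
    {T : ι → Module.End K (M →₀ K)} (hT : ∀ i, HasLeading w (m i) (T i)) :
    LinearIndependent K fun i => T i (Finsupp.single 0 1) := by
  choose s hs hmem using fun i => hT i 0
  simp only [zero_add, map_zero] at hmem
  rw [linearIndependent_iff]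
  intro c hc
  by_contra hne
  obtain ⟨i₀, hi₀, hmax⟩ := c.support.exists_max_image (fun i => w (m i))
    (Finsupp.support_nonempty_iff.2 hne)
  have hcoeff (i : ι) (hi : i ∈ c.support) :
      T i (Finsupp.single 0 1) (m i₀) = s i * Finsupp.single (m i) 1 (m i₀) := by
    have h := (Finsupp.mem_supported' K _).1 (hmem i) (m i₀) (not_lt.2 (hmax i hi))
    rwa [Finsupp.sub_apply, Finsupp.smul_apply, sub_eq_zero] at h
  have h := DFunLike.congr_fun hc (m i₀)
  rw [Finsupp.linearCombination_apply, Finsupp.sum, Finsupp.finsetSum_apply,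
    Finset.sum_eq_single_of_mem i₀ hi₀, Finsupp.smul_apply, hcoeff i₀ hi₀,
    Finsupp.single_eq_same, mul_one] at h
  · exact (mul_ne_zero (Finsupp.mem_support_iff.1 hi₀) (hs i₀)) h
  · intro i hi hne
    rw [Finsupp.smul_apply, hcoeff i hi, Finsupp.single_eq_of_ne (hm.ne hne.symm), mul_zero,
      smul_zero]

variable [IsOrderedCancelAddMonoid Γ]

theorem HasLeading.isLower (hT : HasLeading w m T) (hd : w m < d) : IsLower w d T := by
  intro h
  obtain ⟨s, -, hs⟩ := hT h
  rw [← sub_add_cancel (T (Finsupp.single h 1)) (s • Finsupp.single (h + m) 1)]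
  refine Submodule.add_mem _ (weightLT_mono (add_le_add_right hd.le _) hs)
    (Submodule.smul_mem _ _ (single_mem_weightLT ?_))
  rw [map_add]
  exact add_lt_add_right hd _

theorem HasLeading.apply_mem_weightLT (hT : HasLeading w m T) {v : M →₀ K}
    (hv : v ∈ weightLT K w d) : T v ∈ weightLT K w (d + w m) := by
  suffices h : weightLT K w d ≤ (weightLT K w (d + w m)).comap T from h hv
  rw [weightLT, Finsupp.supported_eq_span_single, Submodule.span_le]
  rintro _ ⟨h, hh, rfl⟩
  obtain ⟨s, -, hs⟩ := hT h
  rw [SetLike.mem_coe, Submodule.mem_comap,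
    ← sub_add_cancel (T (Finsupp.single h 1)) (s • Finsupp.single (h + m) 1)]
  refine Submodule.add_mem _ (weightLT_mono (add_le_add_left (le_of_lt hh) _) hs)
    (Submodule.smul_mem _ _ (single_mem_weightLT ?_))
  rw [map_add]
  exact add_lt_add_left hh _

theorem HasLeading.mul (hS : HasLeading w m S) (hT : HasLeading w m' T) :
    HasLeading w (m + m') (S * T) := by
  intro h
  obtain ⟨t, ht, hTmem⟩ := hT h
  obtain ⟨s, hs, hSmem⟩ := hS (h + m')
  refine ⟨t * s, mul_ne_zero ht hs, ?_⟩
  have hsplit : (S * T) (Finsupp.single h 1) - (t * s) • Finsupp.single (h + (m + m')) 1 =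
      S (T (Finsupp.single h 1) - t • Finsupp.single (h + m') 1) +
      t • (S (Finsupp.single (h + m') 1) - s • Finsupp.single (h + m' + m) 1) := by
    rw [map_sub, map_smul, smul_sub, mul_smul, Module.End.mul_apply, add_comm m m', add_assoc]
    abel
  have hweight : w h + w (m + m') = w h + w m' + w m := by rw [map_add, add_comm (w m), add_assoc]
  rw [hsplit, hweight]
  rw [map_add] at hSmem
  exact Submodule.add_mem _ (hS.apply_mem_weightLT hTmem) (Submodule.smul_mem _ _ hSmem)

theorem HasLeading.pow (hT : HasLeading w m T) (k : ℕ) : HasLeading w (k • m) (T ^ k) := by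
  induction k with
  | zero => simpa using hasLeading_one
  | succ k ih =>
    rw [pow_succ, succ_nsmul]
    exact ih.mul hT

theorem hasLeading_orderedMonomial {k : ℕ} {x : ℕ → Module.End K (M →₀ K)} {m : ℕ → M}
    (h : ∀ l < k, HasLeading w (m l) (x l)) (a : Fin k → ℕ) :
    HasLeading w (∑ l, a l • m l) (orderedMonomial x k a) := by
  induction k with
  | zero => simpa [orderedMonomial] using hasLeading_one
  | succ k ih =>
    rw [Fin.sum_univ_castSucc, orderedMonomial]
    exact (ih (fun l hl => h l (by omega)) (Fin.init a)).mul ((h k k.lt_succ_self).pow _)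

end LeadingTerms

section QuantumTorus

variable {K I : Type*} [Field K] {q : K}

/-- The variable `p` of the quantum torus with exponents `B`, acting on Laurent polynomials: it
multiplies the monomial `h` by the variable `p` and by the scalar `q ^ ∑ r, h r * B p r`. -/
noncomputable def torusOp (q : K) (B : I → I → ℤ) (p : I) : Module.End K ((I →₀ ℤ) →₀ K) :=
  Finsupp.linearCombination K fun h =>
    Finsupp.single (h + Finsupp.single p 1) (q ^ Finsupp.linearCombination ℤ (B p) h)

theorem torusOp_single (B : I → I → ℤ) (p : I) (h : I →₀ ℤ) :
    torusOp q B p (Finsupp.single h 1) =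
      q ^ Finsupp.linearCombination ℤ (B p) h • Finsupp.single (h + Finsupp.single p 1) 1 := by
  simp [torusOp]

theorem qCommute_torusOp (hq : q ≠ 0) (B : I → I → ℤ) (p r : I) :
    QCommute (q ^ (B p r - B r p)) (torusOp q B p) (torusOp q B r) := by
  refine Finsupp.lhom_ext' fun h => LinearMap.ext_ring ?_
  simp only [LinearMap.comp_apply, Finsupp.lsingle_apply, Module.End.mul_apply,
    LinearMap.smul_apply, torusOp_single, map_smul, map_add, smul_smul,
    Finsupp.linearCombination_single, one_smul]
  rw [add_right_comm, ← zpow_add₀ hq, ← zpow_add₀ hq, ← zpow_add₀ hq]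
  congr 2
  ring

theorem hasLeading_torusOp {Γ : Type*} [AddCommMonoid Γ] [LinearOrder Γ]
    (w : (I →₀ ℤ) →+ Γ) (hq : q ≠ 0) (B : I → I → ℤ) (p : I) :
    HasLeading w (Finsupp.single p 1) (torusOp q B p) := by
  intro h
  rw [torusOp_single]
  exact ⟨_, zpow_ne_zero _ hq, by rw [sub_self]; exact Submodule.zero_mem _⟩

open Classical in
/-- The exponents of the quantum torus in which the Feigin homomorphism takes its values: `-a_{ij}`
for the Cartan matrix of type `A_∞` if the variable `p` comes earlier. -/
noncomputable def torusForm (p r : ℤ × ℕ) : ℤ :=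
  if Earlier p r then if p.1 = r.1 then -2 else if p.1 + 1 = r.1 ∨ r.1 + 1 = p.1 then 1 else 0
  else 0

/-- The variables of the quantum torus which occur in the Feigin homomorphism, the others being
replaced by zero: fewer colours are available at the nodes farther from the middle. -/
noncomputable def torusVar (n : ℕ) (q : K) (i : ℤ) (k : ℕ) : Module.End K ((ℤ × ℕ →₀ ℤ) →₀ K) :=
  if i.natAbs + k < n then torusOp q torusForm (i, k) else 0

theorem colourSum_torusVar_eq_zero {n : ℕ} {i : ℤ} (h : n ≤ i.natAbs) :
    colourSum (torusVar n q) n i = 0 :=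
  Finset.sum_eq_zero fun _ _ => if_neg (by omega)

theorem qCommute_torusVar (n : ℕ) (hq : q ≠ 0) (i j : ℤ) (k l : ℕ) :
    QCommute (q ^ (torusForm (i, k) (j, l) - torusForm (j, l) (i, k)))
      (torusVar n q i k) (torusVar n q j l) := by
  unfold torusVar
  split_ifs
  · exact qCommute_torusOp hq _ _ _
  all_goals simp [QCommute]

theorem isTorusFamily_torusVar (n : ℕ) (hq : q ≠ 0) : IsTorusFamily q (torusVar n q) where
  commute {i j} k l h := by
    have hform : torusForm (i, k) (j, l) - torusForm (j, l) (i, k) = 0 := by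
      unfold torusForm
      split_ifs <;> omega
    have := qCommute_torusVar n hq i j k l
    rw [hform, zpow_zero] at this
    exact this.commute
  adjacent {i j k l} h hlt := by
    have hform : torusForm (i, k) (j, l) - torusForm (j, l) (i, k) = 1 := by
      unfold torusForm
      unfold Earlier at *
      split_ifs <;> omega
    have := qCommute_torusVar n hq i j k l
    rwa [hform, zpow_one] at this
  same i {k l} h := by
    have hform : torusForm (i, k) (i, l) - torusForm (i, l) (i, k) = -2 := by
      unfold torusForm
      unfold Earlier at *
      split_ifs <;> omega
    have := qCommute_torusVar n hq i i k l
    rwa [hform, zpow_neg, zpow_ofNat, ← inv_pow] at this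

/-- The exponent of the monomial `hook y c i j`. -/
noncomputable def hookExponent (c : ℤ → ℕ) (i j : ℕ) : ℤ × ℕ →₀ ℤ :=
  ∑ t ∈ Finset.Icc (-i : ℤ) j, Finsupp.single (t, c t) 1

variable {c : ℤ → ℕ} {n i j : ℕ}

theorem hookExponent_zero_succ : hookExponent c 0 (j + 1) =
    Finsupp.single ((j + 1 : ℤ), c (j + 1)) 1 + hookExponent c 0 j := by
  have hinsert : Finset.Icc (-(0 : ℕ) : ℤ) ↑(j + 1) =
      insert (j + 1 : ℤ) (Finset.Icc (-(0 : ℕ) : ℤ) j) := by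
    ext
    simp only [Finset.mem_insert, Finset.mem_Icc]
    omega
  rw [hookExponent, hookExponent, hinsert, Finset.sum_insert (by simp)]

theorem hookExponent_succ : hookExponent c (i + 1) j =
    Finsupp.single (-(i + 1 : ℤ), c (-(i + 1))) 1 + hookExponent c i j := by
  have hinsert : Finset.Icc (-↑(i + 1) : ℤ) j =
      insert (-(i + 1 : ℤ)) (Finset.Icc (-i : ℤ) j) := by
    ext
    simp only [Finset.mem_insert, Finset.mem_Icc]
    omega
  rw [hookExponent, hookExponent, hinsert, Finset.sum_insert (by simp)]

theorem hasLeading_hook {Γ : Type*} [AddCommMonoid Γ] [LinearOrder Γ]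
    [IsOrderedCancelAddMonoid Γ] (w : (ℤ × ℕ →₀ ℤ) →+ Γ) (hq : q ≠ 0)
    (h : ∀ t ∈ Set.Icc (-i : ℤ) j, t.natAbs + c t < n) :
    HasLeading w (hookExponent c i j) (hook (torusVar n q) c i j) := by
  have hvar {t : ℤ} {k : ℕ} (h : t.natAbs + k < n) :
      HasLeading w (Finsupp.single (t, k) 1) (torusVar n q t k) := by
    rw [torusVar, if_pos h]
    exact hasLeading_torusOp w hq _ _
  induction i with
  | zero =>
    induction j with
    | zero => simpa [hookExponent, hook_zero] using hvar (h 0 (by simp))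
    | succ j ih =>
      rw [hookExponent_zero_succ, hook_zero_succ]
      exact (hvar (h _ (by constructor <;> push_cast <;> omega))).mul
        (ih fun t ht => h t ⟨ht.1, ht.2.trans (by push_cast; omega)⟩)
  | succ i ih =>
    rw [hookExponent_succ, hook_succ]
    exact (hvar (h _ (by constructor <;> push_cast <;> omega))).mul
      (ih fun t ht => h t ⟨le_trans (by push_cast; omega) ht.1, ht.2⟩)

/-- The weight by which the monomials of the quantum torus are compared: `2 n` times the colour at
the middle node minus the sum of the colours at the other nodes, so that among the non-zero hooks on
an interval the constant one of maximal colour wins. -/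
noncomputable def torusWeight (n : ℕ) : (ℤ × ℕ →₀ ℤ) →+ ℤ :=
  (Finsupp.linearCombination ℤ fun p : ℤ × ℕ =>
    (if p.1 = 0 then (2 * n + 1) * (p.2 : ℤ) else 0) - p.2).toAddMonoidHom

theorem torusWeight_hookExponent (n : ℕ) (c : ℤ → ℕ) (i j : ℕ) :
    torusWeight n (hookExponent c i j) =
      (2 * n + 1) * c 0 - ∑ t ∈ Finset.Icc (-i : ℤ) j, (c t : ℤ) := by
  simp [torusWeight, hookExponent]

theorem torusWeight_hookExponent_const (n k i j : ℕ) :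
    torusWeight n (hookExponent (fun _ => k) i j) = (2 * n - i - j) * k := by
  have hcard : ((Finset.Icc (-i : ℤ) j).card : ℤ) = i + j + 1 := by
    rw [Int.card_Icc]
    omega
  rw [torusWeight_hookExponent, Finset.sum_const, nsmul_eq_mul, hcard]
  ring

theorem torusWeight_hookExponent_lt (hc : IsVShaped c)
    (hlt : ∃ t ∈ Set.Icc (-i : ℤ) j, c 0 < c t) :
    torusWeight n (hookExponent c i j) < (2 * n - i - j) * c 0 := by
  have hmin (t : ℤ) : c 0 ≤ c t := by
    rcases le_total t 0 with ht | ht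
    · exact hc.1 ht Set.self_mem_Iic ht
    · exact hc.2 Set.self_mem_Ici ht ht
  obtain ⟨t, ht, hlt⟩ := hlt
  have hsum : ∑ _t ∈ Finset.Icc (-i : ℤ) j, (c 0 : ℤ) < ∑ t ∈ Finset.Icc (-i : ℤ) j, (c t : ℤ) :=
    Finset.sum_lt_sum (fun t _ => by exact_mod_cast hmin t)
      ⟨t, Finset.mem_Icc.2 ht, by exact_mod_cast hlt⟩
  rw [← torusWeight_hookExponent_const n (c 0), torusWeight_hookExponent, torusWeight_hookExponent]
  exact sub_lt_sub_left hsum _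

theorem isLower_hook {Γ : Type*} [AddCommMonoid Γ] [LinearOrder Γ] [IsOrderedCancelAddMonoid Γ]
    {w : (ℤ × ℕ →₀ ℤ) →+ Γ} {d : Γ} (hq : q ≠ 0)
    (h : (∀ t ∈ Set.Icc (-i : ℤ) j, t.natAbs + c t < n) → w (hookExponent c i j) < d) :
    IsLower w d (hook (torusVar n q) c i j) := by
  by_cases hcn : ∀ t ∈ Set.Icc (-i : ℤ) j, t.natAbs + c t < n
  · exact (hasLeading_hook w hq hcn).isLower (h hcn)
  · push Not at hcn
    obtain ⟨t, ht, htn⟩ := hcn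
    rw [hook_eq_zero ht (if_neg (by omega))]
    exact isLower_zero

/-- The exponent of the leading term of a grid vector in the quantum torus. -/
noncomputable def leadingExponent (n i j : ℕ) : ℤ × ℕ →₀ ℤ :=
  hookExponent (fun _ => n - 1 - max i j) i j

theorem isLower_of_mem_hookSpan (hq : q ≠ 0) (hi : i < n) (hj : j < n)
    {T : Module.End K ((ℤ × ℕ →₀ ℤ) →₀ K)} (hT : T ∈ hookSpan K (torusVar n q) i j) :
    IsLower (torusWeight n) (torusWeight n (leadingExponent n i j)) T := by
  induction hT using Submodule.span_induction with
  | mem T hT =>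
    obtain ⟨c, hc, hlt, rfl⟩ := hT
    refine isLower_hook hq fun hcn => (torusWeight_hookExponent_lt hc hlt).trans_le ?_
    have hci : c 0 ≤ c (-i) := hc.1 (by simp) (by simp) (by simp)
    have hcj : c 0 ≤ c j := hc.2 (by simp) (by simp) (by simp)
    have hin := hcn (-i) (by simp)
    have hjn := hcn j (by simp)
    rw [leadingExponent, torusWeight_hookExponent_const]
    exact mul_le_mul_of_nonneg_left (by exact_mod_cast (by omega : c 0 ≤ n - 1 - max i j))
      (by omega)
  | zero => exact isLower_zero
  | add S T _ _ hS hT => exact hS.add hT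
  | smul r T _ hT => exact hT.smul r

theorem hasLeading_grid (hq : q ≠ 0) (hq2 : q ^ 2 ≠ 1) (hi : i < n) (hj : j < n) :
    HasLeading (torusWeight n) (leadingExponent n i j)
      (grid q (colourSum (torusVar n q) n) i j) := by
  have hlower := isLower_of_mem_hookSpan hq hi hj
    ((isTorusFamily_torusVar n hq).grid_sub_mem_hookSpan hq n i j)
  have hmem : n - 1 - max i j ∈ Finset.range n := Finset.mem_range.2 (by omega)
  have hother : IsLower (torusWeight n) (torusWeight n (leadingExponent n i j))
      (∑ k ∈ (Finset.range n).erase (n - 1 - max i j),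
        hook (torusVar n q) (fun _ => k) i j) := by
    refine IsLower.sum fun k hk => isLower_hook hq fun hkn => ?_
    have hin := hkn (-i) (by simp)
    have hjn := hkn j (by simp)
    have hne := Finset.ne_of_mem_erase hk
    rw [leadingExponent, torusWeight_hookExponent_const, torusWeight_hookExponent_const]
    exact mul_lt_mul_of_pos_left (by exact_mod_cast (by omega : k < n - 1 - max i j)) (by omega)
  have hlead : HasLeading (torusWeight n) (leadingExponent n i j)
      (hook (torusVar n q) (fun _ => n - 1 - max i j) i j) :=
    hasLeading_hook _ hq fun t ht => by
      rw [Set.mem_Icc] at ht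
      omega
  have hscalar : (1 - q ^ 2) ^ (i + j) ≠ 0 := pow_ne_zero _ (sub_ne_zero.2 hq2.symm)
  have hsum := (hlead.add_isLower hother).smul hscalar
  rw [Finset.add_sum_erase _ (fun k => hook (torusVar n q) (fun _ => k) i j) hmem] at hsum
  rw [← add_sub_cancel
    ((1 - q ^ 2) ^ (i + j) • ∑ k ∈ Finset.range n, hook (torusVar n q) (fun _ => k) i j)
    (grid q (colourSum (torusVar n q) n) i j)]
  exact hsum.add_isLower hlower

theorem hookExponent_const_apply (k i j : ℕ) (t : ℤ) (l : ℕ) :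
    hookExponent (fun _ => k) i j (t, l) = if l = k ∧ -i ≤ t ∧ t ≤ j then 1 else 0 := by
  simp only [hookExponent, Finsupp.finsetSum_apply, Finsupp.single_apply, Prod.mk.injEq,
    ite_and, Finset.sum_ite_eq', Finset.mem_Icc]
  split_ifs <;> omega

/-- Functionals dual to the leading exponents: an interval `[-i, j]` whose ends are not symmetric is
detected at the colour `n - 1 - max i j` by the end nearer to the middle, which no other interval
with the same farther end shares. -/
noncomputable def dualForm (n i j : ℕ) : (ℤ × ℕ →₀ ℤ) →ₗ[ℤ] ℤ :=
  let coeff (t : ℤ) : (ℤ × ℕ →₀ ℤ) →ₗ[ℤ] ℤ := Finsupp.lapply (t, n - 1 - max i j)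
  if j < i then coeff j - coeff (j + 1)
  else if i < j then coeff (-i) - coeff (-i - 1)
  else coeff i + coeff (-i) - coeff 0

theorem dualForm_leadingExponent {s t : ℕ} (hi : i < n) (hj : j < n) (hs : s < n) (ht : t < n) :
    dualForm n i j (leadingExponent n s t) = if i = s ∧ j = t then 1 else 0 := by
  have hmax : n - 1 - max i j = n - 1 - max s t ↔ max i j = max s t := by omega
  unfold dualForm leadingExponent
  split_ifs <;> simp only [LinearMap.sub_apply, LinearMap.add_apply, Finsupp.lapply_apply,
    hookExponent_const_apply, hmax] <;> split_ifs <;> omega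

theorem linearIndependent_leadingExponent (n : ℕ) :
    LinearIndependent ℤ fun p : Fin n × Fin n => leadingExponent n p.1 p.2 := by
  refine .of_pairwise_dual_eq_zero_one _ (fun p => dualForm n p.1 p.2) (fun p r hpr => ?_)
    fun p => ?_
  · have hne : ¬((p.1 : ℕ) = r.1 ∧ (p.2 : ℕ) = r.2) := fun ⟨h₁, h₂⟩ =>
      hpr (Prod.ext (Fin.ext h₁) (Fin.ext h₂))
    exact (dualForm_leadingExponent p.1.2 p.2.2 r.1.2 r.2.2).trans (if_neg hne)
  · rw [dualForm_leadingExponent p.1.2 p.2.2 p.1.2 p.2.2, if_pos ⟨rfl, rfl⟩]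

theorem linearIndependent_orderedMonomial_grid (hq : q ≠ 0) (hq2 : q ^ 2 ≠ 1) :
    LinearIndependent K fun a => orderedMonomial
      (lexVar fun p : Fin n × Fin n => grid q (colourSum (torusVar n q) n) p.1 p.2) (n * n) a
      (Finsupp.single 0 1) := by
  let m : Fin n × Fin n → ℤ × ℕ →₀ ℤ := fun p => leadingExponent n p.1 p.2
  have hm : Function.Injective fun a : Fin (n * n) → ℕ => ∑ l, a l • lexVar m l := by
    have hli := ((linearIndependent_leadingExponent n).comp _
      finProdFinEquiv.symm.injective).restrict_scalars (R := ℕ) fun a b h => by simpa using h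
    simpa only [m, lexVar_coe, Fintype.linearCombination_apply, Function.comp_def] using!
      hli.fintypeLinearCombination_injective
  refine linearIndependent_of_hasLeading hm fun a =>
    hasLeading_orderedMonomial (w := torusWeight n) (fun l hl => ?_) a
  rw [lexVar_of_lt _ hl, lexVar_of_lt _ hl]
  exact hasLeading_grid hq hq2 (Fin.is_lt _) (Fin.is_lt _)

end QuantumTorus

/-! ### The generators `Z_{i,j}` as iterated `q`-commutators -/

section Nodes

/-- A family indexed by the nodes of the diagram of type `A_{2n-1}`, renumbered so that the middle
node becomes `0`, and extended by zero to the diagram `A_∞`. -/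
def extendNodes {A : Type*} [Zero A] (n : ℕ) (f : Fin (2 * n - 1) → A) (k : ℤ) : A :=
  if h : k.natAbs < n then f ⟨(n - 1 + k).toNat, by omega⟩ else 0

theorem cartan_eq_zero_iff {r : ℕ} {i j : Fin r} :
    CartanMatrix.A r i j = 0 ↔ (i : ℤ) + 1 < j ∨ (j : ℤ) + 1 < i := by
  simp only [CartanMatrix.A, Matrix.of_apply, Fin.ext_iff]
  split_ifs <;> grind

theorem cartan_eq_neg_one_iff {r : ℕ} {i j : Fin r} :
    CartanMatrix.A r i j = -1 ↔ (i : ℤ) + 1 = j ∨ (j : ℤ) + 1 = i := by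
  simp only [CartanMatrix.A, Matrix.of_apply, Fin.ext_iff]
  split_ifs <;> grind

theorem isSerreFamily_extendNodes {K A : Type*} [Field K] [Ring A] [Algebra K A] {q : K} {n : ℕ}
    {f : Fin (2 * n - 1) → A}
    (hcomm : ∀ i j, CartanMatrix.A (2 * n - 1) i j = 0 → Commute (f i) (f j))
    (hserre : ∀ i j, CartanMatrix.A (2 * n - 1) i j = -1 → serreElt q (f i) (f j) = 0) :
    IsSerreFamily q (extendNodes n f) where
  commute {i j} h := by
    unfold extendNodes
    split_ifs
    · exact hcomm _ _ (cartan_eq_zero_iff.2 (by simp only; omega))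
    all_goals simp
  serre_eq_zero {i j} h := by
    unfold extendNodes
    split_ifs
    · exact hserre _ _ (cartan_eq_neg_one_iff.2 (by simp only; omega))
    all_goals simp [serreElt]

section

variable {A : Type*} [Zero A] {n k : ℕ} (f : Fin (2 * n - 1) → A)

theorem extendNodes_nuNode (h : k < n) : extendNodes n f k = f (nuNode n k h) := by
  rw [extendNodes, dif_pos (by omega)]
  congr 1
  ext
  simp only [nuNode]
  omega

theorem extendNodes_muNode (h : k < n) : extendNodes n f (-k) = f (muNode n k h) := by
  rw [extendNodes, dif_pos (by omega)]
  congr 1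
  ext
  simp only [muNode]
  omega

end

theorem pairing_add {r : ℕ} (γ γ' : RootLattice r) (ζ : WeightLattice r) :
    pairing (γ + γ') ζ = pairing γ ζ + pairing γ' ζ := by
  simp [pairing, add_mul, Finset.sum_add_distrib]

theorem pairing_simpleRoot_toWeight {r : ℕ} (i j : Fin r) :
    pairing (simpleRoot i) (toWeight (simpleRoot j)) = CartanMatrix.A r i j := by
  rw [pairing_simpleRoot, toWeight_simpleRoot]

theorem pairing_rootNat_of_notMem {n i j : ℕ} (hi : i < n) (hj : j < n) {m : Fin (2 * n - 1)}
    (h : (m : ℤ) ∉ Set.Icc (n - 1 - i : ℤ) (n - 1 + j)) :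
    pairing (rootNat n i j hi hj) (toWeight (simpleRoot m)) =
      if (m : ℤ) = n - 1 - (i + 1) ∨ (m : ℤ) = n - 1 + (j + 1) then -1 else 0 := by
  rw [Set.mem_Icc] at h
  induction i with
  | zero =>
    induction j with
    | zero =>
      rw [rootNat, pairing_simpleRoot_toWeight]
      simp only [CartanMatrix.A, Matrix.of_apply, Fin.ext_iff, betaNode]
      split_ifs <;> omega
    | succ j ih =>
      rw [rootNat, pairing_add, ih (by omega) (by omega), pairing_simpleRoot_toWeight]
      simp only [CartanMatrix.A, Matrix.of_apply, Fin.ext_iff, nuNode]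
      split_ifs <;> omega
  | succ i ih =>
    rw [rootNat, pairing_add, ih (by omega) (by omega), pairing_simpleRoot_toWeight]
    simp only [CartanMatrix.A, Matrix.of_apply, Fin.ext_iff, muNode]
    split_ifs <;> omega

variable {q : ℂ}

theorem adE_eq_qComm {r : ℕ} {k : Fin r} {γ : RootLattice r}
    (h : pairing γ (toWeight (simpleRoot k)) = -1) (x : Uq r q) :
    adE q k γ x = qComm q (E q k) x := by
  rw [adE, h, neg_neg, zpow_one, qComm]

theorem ZNat_eq_grid {n i j : ℕ} (hi : i < n) (hj : j < n) :
    ZNat n q i j hi hj = grid q (extendNodes n (E q)) i j := by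
  induction i with
  | zero =>
    induction j with
    | zero =>
      rw [ZNat, grid_zero, ← Nat.cast_zero, extendNodes_nuNode _ hi]
      rfl
    | succ j ih =>
      have hpair : pairing (rootNat n 0 j hi (by omega))
          (toWeight (simpleRoot (nuNode n (j + 1) hj))) = -1 := by
        rw [pairing_rootNat_of_notMem, if_pos] <;> simp [nuNode] <;> omega
      rw [ZNat, adE_eq_qComm hpair, ih, ← extendNodes_nuNode (E q) hj, Nat.cast_succ, grid]
  | succ i ih =>
    have hpair : pairing (rootNat n i j (by omega) hj)
        (toWeight (simpleRoot (muNode n (i + 1) hi))) = -1 := by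
      rw [pairing_rootNat_of_notMem, if_pos] <;> simp [muNode] <;> omega
    rw [ZNat, adE_eq_qComm hpair, ih, ← extendNodes_muNode (E q) hi, Nat.cast_succ,
      grid_succ_left]

theorem Z_eq_grid {n : ℕ} (i j : Fin n) : Z q i j = grid q (extendNodes n (E q)) i j :=
  ZNat_eq_grid i.2 j.2

theorem isSerreFamily_extendNodes_E (n : ℕ) :
    IsSerreFamily q (extendNodes n (E (r := 2 * n - 1) q)) := by
  refine isSerreFamily_extendNodes (fun i j h => ?_) fun i j h => ?_
  · have hrel := RingQuot.mkAlgHom_rel ℂ (UqRel.E_comm (q := q) i j h)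
    rwa [map_mul, map_mul] at hrel
  · have hrel : RingQuot.mkAlgHom ℂ (UqRel (2 * n - 1) q) (serreElt q _ _) = _ :=
      RingQuot.mkAlgHom_rel ℂ (UqRel.E_serre (q := q) i j h)
    rwa [map_serreElt, map_zero] at hrel

end Nodes

/-! ### The Feigin homomorphism on the ordered monomials -/

section LexVar

variable {A B : Type*} {n : ℕ}

theorem lexVar_finProdFinEquiv [Zero A] (f : Fin n × Fin n → A) (p : Fin n × Fin n) :
    lexVar f (finProdFinEquiv p : Fin (n * n)) = f p := by
  rw [lexVar_coe, Equiv.symm_apply_apply]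

theorem image_lexVar [Zero A] (f : Fin n × Fin n → A) :
    lexVar f '' Set.Iio (n * n) = Set.range f := by
  ext a
  constructor
  · rintro ⟨l, hl, rfl⟩
    exact ⟨_, (lexVar_of_lt f hl).symm⟩
  · rintro ⟨p, rfl⟩
    exact ⟨_, (finProdFinEquiv p).2, lexVar_finProdFinEquiv f p⟩

theorem map_comp_lexVar {F : Type*} [Zero A] [Zero B] [FunLike F A B] [ZeroHomClass F A B] (f : F)
    (g : Fin n × Fin n → A) : f ∘ lexVar g = lexVar (f ∘ g) := by
  ext l
  simp only [Function.comp_apply, lexVar, apply_dite f, map_zero]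

theorem map_orderedMonomial_lexVar {F : Type*} [MonoidWithZero A] [MonoidWithZero B] [FunLike F A B]
    [MonoidWithZeroHomClass F A B] (f : F) (g : Fin n × Fin n → A) (a : Fin (n * n) → ℕ) :
    f (orderedMonomial (lexVar g) (n * n) a) = orderedMonomial (lexVar (f ∘ g)) (n * n) a := by
  rw [← map_comp_lexVar]
  exact map_orderedMonomial _ _ (f : A →* B) a

end LexVar

section Feigin

variable {K : Type*} [Field K] {q : K}

/-- The Feigin homomorphism from the positive part to the quantum torus; it maps each `E_i` to the
sum of the variables at the node `i`. -/
noncomputable def feiginHom (n : ℕ) (hq : q ≠ 0) :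
    UPos (2 * n - 1) q →ₐ[K] Module.End K ((ℤ × ℕ →₀ ℤ) →₀ K) :=
  have hserre := (isTorusFamily_torusVar n hq).isSerreFamily_colourSum hq n
  posLift (fun i => colourSum (torusVar n q) n (i - (n - 1)))
    (fun i j h => (hserre.commute (by rw [cartan_eq_zero_iff] at h; omega)).eq)
    fun i j h => hserre.serre_eq_zero (by rw [cartan_eq_neg_one_iff] at h; omega)

theorem feiginHom_extendNodes (n : ℕ) (hq : q ≠ 0) (k : ℤ) :
    feiginHom n hq (extendNodes n (posE q) k) = colourSum (torusVar n q) n k := by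
  unfold extendNodes
  split_ifs with h
  · rw [feiginHom, posLift_posE]
    congr 1
    simp only
    omega
  · rw [map_zero, colourSum_torusVar_eq_zero (by omega)]

theorem feiginHom_grid (n : ℕ) (hq : q ≠ 0) (i j : ℕ) :
    feiginHom n hq (grid q (extendNodes n (posE q)) i j) =
      grid q (colourSum (torusVar n q) n) i j := by
  refine (map_grid (B := Module.End K ((ℤ × ℕ →₀ ℤ) →₀ K)) (feiginHom n hq) i j).trans ?_
  congr 1
  exact funext (feiginHom_extendNodes n hq)

variable {n : ℕ} {q : ℂ}

theorem vermaRep_extendNodes (n : ℕ) (hq : q ≠ 0) (k : ℤ) :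
    vermaRep hq (extendNodes n (E q) k) = Algebra.lmul ℂ _ (extendNodes n (posE q) k) := by
  unfold extendNodes
  split_ifs with h
  · exact vermaRep_E hq _
  · rw [map_zero, map_zero]

theorem vermaRep_Z (hq : q ≠ 0) (i j : Fin n) :
    vermaRep hq (Z q i j) = Algebra.lmul ℂ _ (grid q (extendNodes n (posE q)) i j) := by
  rw [Z_eq_grid, map_grid, map_grid]
  congr 1
  exact funext (vermaRep_extendNodes n hq)

/-- The Feigin homomorphism, extended linearly to the whole quantized enveloping algebra by its
action on the lowest weight vector of the Verma module, and evaluated at the monomial `1`. -/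
noncomputable def feiginEval (n : ℕ) (hq : q ≠ 0) :
    Uq (2 * n - 1) q →ₗ[ℂ] (ℤ × ℕ →₀ ℤ) →₀ ℂ :=
  LinearMap.applyₗ (Finsupp.single 0 1) ∘ₗ (feiginHom n hq).toLinearMap ∘ₗ
    LinearMap.applyₗ 1 ∘ₗ (vermaRep hq).toLinearMap

theorem feiginEval_apply (hq : q ≠ 0) (u : Uq (2 * n - 1) q) :
    feiginEval n hq u = feiginHom n hq (vermaRep hq u 1) (Finsupp.single 0 1) := rfl

theorem feiginEval_mul_L (hq : q ≠ 0) (u : Uq (2 * n - 1) q) (θ : WeightLattice (2 * n - 1)) :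
    feiginEval n hq (u * L q θ) = feiginEval n hq u := by
  rw [feiginEval_apply, map_mul, vermaRep_L, Module.End.mul_apply, opL_one, ← feiginEval_apply]

theorem feiginEval_orderedMonomial (hq : q ≠ 0) (a : Fin (n * n) → ℕ) :
    feiginEval n hq (orderedMonomial (lexVar fun p : Fin n × Fin n => Z q p.1 p.2) (n * n) a) =
      orderedMonomial (lexVar fun p : Fin n × Fin n => grid q (colourSum (torusVar n q) n) p.1 p.2)
        (n * n) a (Finsupp.single 0 1) := by
  let g : Fin n × Fin n → UPos (2 * n - 1) q := fun p => grid q (extendNodes n (posE q)) p.1 p.2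
  have hverma : vermaRep hq (orderedMonomial (lexVar fun p : Fin n × Fin n => Z q p.1 p.2)
      (n * n) a) = Algebra.lmul ℂ _ (orderedMonomial (lexVar g) (n * n) a) := by
    refine (map_orderedMonomial_lexVar (vermaRep hq) _ a).trans
      (.trans ?_ (map_orderedMonomial_lexVar (Algebra.lmul ℂ _) g a).symm)
    congr 2
    exact funext fun p => vermaRep_Z hq p.1 p.2
  have hfeigin : feiginHom n hq (orderedMonomial (lexVar g) (n * n) a) = orderedMonomial
      (lexVar fun p : Fin n × Fin n => grid q (colourSum (torusVar n q) n) p.1 p.2) (n * n) a := by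
    refine (map_orderedMonomial_lexVar (feiginHom n hq) g a).trans ?_
    congr 2
    exact funext fun p => feiginHom_grid n hq p.1 p.2
  rw [feiginEval_apply, hverma, Algebra.coe_lmul_eq_mul, LinearMap.mul_apply', mul_one, hfeigin]

end Feigin

/-! ### The modified algebras -/

section Weights

variable {q : ℂ} {r : ℕ}

theorem L_zero : L (r := r) q 0 = 1 := by
  rw [L, RingQuot.mkAlgHom_rel ℂ UqRel.L_zero, map_one]

theorem L_mul_L (θ θ' : WeightLattice r) : L q θ * L q θ' = L q (θ + θ') := by
  rw [L, L, ← map_mul, RingQuot.mkAlgHom_rel ℂ (UqRel.L_add θ θ'), L]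

/-- The element `x` of the quantized enveloping algebra has weight `γ`. -/
def HasWeight (γ : RootLattice r) (x : Uq r q) : Prop :=
  ∀ θ, QCommute (q ^ pairing γ θ) (L q θ) x

theorem hasWeight_one : HasWeight 0 (1 : Uq r q) := by
  intro θ
  simp [QCommute, pairing]

theorem hasWeight_E (i : Fin r) : HasWeight (simpleRoot i) (E q i) := by
  intro θ
  rw [QCommute, L, E, ← map_mul, RingQuot.mkAlgHom_rel ℂ (UqRel.L_E θ i), map_smul, map_mul]

variable {γ γ' : RootLattice r} {x y : Uq r q}

namespace HasWeight

theorem mul (hq : q ≠ 0) (hx : HasWeight γ x) (hy : HasWeight γ' y) :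
    HasWeight (γ + γ') (x * y) := by
  intro θ
  rw [pairing_add, zpow_add₀ hq]
  exact (hx θ).mul_right (hy θ)

theorem adE (hq : q ≠ 0) (hx : HasWeight γ x) (k : Fin r) (γ' : RootLattice r) :
    HasWeight (γ + simpleRoot k) (adE q k γ' x) := by
  intro θ
  have hleft := (hasWeight_E k).mul hq hx θ
  have hright := hx.mul hq (hasWeight_E k) θ
  rw [add_comm] at hleft
  rw [QCommute, QuantumMatrix.adE, mul_sub, mul_smul_comm, hleft, hright, sub_mul, smul_mul_assoc,
    smul_sub, smul_comm]

theorem mul_L_mul_mul_L (hy : HasWeight γ y) (x : Uq r q) (θ θ' : WeightLattice r) :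
    x * L q θ * (y * L q θ') = q ^ pairing γ θ • (x * y * L q (θ + θ')) := by
  rw [mul_assoc, ← mul_assoc (L q θ), hy, smul_mul_assoc, mul_smul_comm, mul_assoc y, L_mul_L,
    mul_assoc]

theorem qCommute_mul_L (hq : q ≠ 0) (hx : HasWeight γ x) (hy : HasWeight γ' y) {m : ℤ}
    (h : QCommute (q ^ m) x y) (θ θ' : WeightLattice r) :
    QCommute (q ^ (pairing γ' θ - pairing γ θ' + m)) (x * L q θ) (y * L q θ') := by
  rw [QCommute, hy.mul_L_mul_mul_L, hx.mul_L_mul_mul_L, h, smul_mul_assoc, smul_smul, smul_smul,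
    ← zpow_add₀ hq, ← zpow_add₀ hq, add_comm θ']
  congr 2
  ring

end HasWeight

theorem hasWeight_ZNat (hq : q ≠ 0) {n i j : ℕ} (hi : i < n) (hj : j < n) :
    HasWeight (rootNat n i j hi hj) (ZNat n q i j hi hj) := by
  induction i with
  | zero =>
    induction j with
    | zero =>
      rw [rootNat, ZNat]
      exact hasWeight_E _
    | succ j ih =>
      rw [rootNat, ZNat]
      exact (ih _).adE hq _ _
  | succ i ih =>
    rw [rootNat, ZNat, add_comm]
    exact (ih _).adE hq _ _

theorem hasWeight_Z (hq : q ≠ 0) {n : ℕ} (i j : Fin n) : HasWeight (root i j) (Z q i j) :=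
  hasWeight_ZNat hq i.2 j.2

/-- The element `y` is a non-zero multiple of `x L_θ` for some weight `θ`, where `x` is a weight
vector. -/
def IsTwist (x y : Uq r q) : Prop :=
  ∃ γ, HasWeight γ x ∧ ∃ c : ℂ, c ≠ 0 ∧ ∃ θ, y = c • (x * L q θ)

theorem isTwist_one : IsTwist (1 : Uq r q) 1 :=
  ⟨0, hasWeight_one, 1, one_ne_zero, 0, by rw [L_zero, mul_one, one_smul]⟩

namespace IsTwist

theorem mul (hq : q ≠ 0) {x' y' : Uq r q} (h : IsTwist x y) (h' : IsTwist x' y') :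
    IsTwist (x * x') (y * y') := by
  obtain ⟨γ, hx, c, hc, θ, rfl⟩ := h
  obtain ⟨γ', hx', c', hc', θ', rfl⟩ := h'
  refine ⟨γ + γ', hx.mul hq hx', c * c' * q ^ pairing γ' θ,
    mul_ne_zero (mul_ne_zero hc hc') (zpow_ne_zero _ hq), θ + θ', ?_⟩
  rw [smul_mul_smul_comm, hx'.mul_L_mul_mul_L, smul_smul]

theorem pow (hq : q ≠ 0) (h : IsTwist x y) (m : ℕ) : IsTwist (x ^ m) (y ^ m) := by
  induction m with
  | zero => simpa only [pow_zero] using isTwist_one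
  | succ m ih => simpa only [pow_succ] using ih.mul hq h

theorem orderedMonomial (hq : q ≠ 0) {x y : ℕ → Uq r q} {k : ℕ}
    (h : ∀ l < k, IsTwist (x l) (y l)) (a : Fin k → ℕ) :
    IsTwist (orderedMonomial x k a) (orderedMonomial y k a) := by
  induction k with
  | zero => exact isTwist_one
  | succ k ih =>
    exact (ih (fun l hl => h l (by omega)) _).mul hq ((h k (by omega)).pow hq _)

end IsTwist

end Weights

section Relations

variable {n : ℕ} {q : ℂ} (ζ ξ : Fin n → WeightLattice (2 * n - 1))

theorem Zt_eq (i j : Fin n) : Zt q ζ ξ i j = Z q i j * L q (ζ i + ξ j) := by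
  rw [Zt, mul_assoc, L_mul_L]

theorem isTwist_Zt (hq : q ≠ 0) (i j : Fin n) : IsTwist (Z q i j) (Zt q ζ ξ i j) :=
  ⟨root i j, hasWeight_Z hq i j, 1, one_ne_zero, ζ i + ξ j, by rw [one_smul, Zt_eq]⟩

theorem qCommute_Zt (hq : q ≠ 0) {i j s t : Fin n} {m : ℤ}
    (h : QCommute (q ^ m) (Z q i j) (Z q s t)) :
    QCommute (q ^ (pairing (root s t) (ζ i + ξ j) - pairing (root i j) (ζ s + ξ t) + m))
      (Zt q ζ ξ i j) (Zt q ζ ξ s t) := by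
  rw [Zt_eq, Zt_eq]
  exact (hasWeight_Z hq i j).qCommute_mul_L hq (hasWeight_Z hq s t) h _ _

theorem Zt_mul_Zt_diag (hq : q ≠ 0) (hq2 : q ^ 2 + 1 ≠ 0) {i j s t : Fin n} (his : i < s)
    (hjt : j < t) :
    Zt q ζ ξ i j * Zt q ζ ξ s t =
      q ^ (pairing (root s t) (ζ i + ξ j) - pairing (root i j) (ζ s + ξ t)) •
          (Zt q ζ ξ s t * Zt q ζ ξ i j) +
        ((q - q⁻¹) * q ^ (pairing (root s t) (ζ i + ξ j) - pairing (root s j) (ζ i + ξ t))) •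
          (Zt q ζ ξ i t * Zt q ζ ξ s j) := by
  have hZ : Z q i j * Z q s t = Z q s t * Z q i j + (q - q⁻¹) • (Z q i t * Z q s j) := by
    simp only [Z_eq_grid]
    rw [← sub_eq_iff_eq_add']
    exact (isSerreFamily_extendNodes_E n).grid_diag hq hq2 his hjt
  have hweights : ζ i + ξ t + (ζ s + ξ j) = ζ i + ξ j + (ζ s + ξ t) := by abel
  simp only [Zt_eq, (hasWeight_Z hq _ _).mul_L_mul_mul_L]
  rw [hZ, add_mul, smul_mul_assoc, hweights, add_comm (ζ s + ξ t), smul_smul, smul_smul, smul_add,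
    smul_smul, ← zpow_add₀ hq, mul_assoc (q - q⁻¹), ← zpow_add₀ hq, sub_add_cancel, sub_add_cancel,
    mul_comm (q - q⁻¹)]

theorem sq_add_one_ne_zero (hq4 : 2 ≤ n → q ^ 4 ≠ 1) {i j : Fin n} (h : i < j) :
    q ^ 2 + 1 ≠ 0 := by
  intro hzero
  refine hq4 (by omega) ?_
  linear_combination (q ^ 2 - 1) * hzero

theorem lift_genM_eq_of_modRel (hq : q ≠ 0) (hq4 : 2 ≤ n → q ^ 4 ≠ 1)
    {a b : FreeAlgebra ℂ (Fin n × Fin n)} (h : ModRel q ζ ξ a b) :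
    FreeAlgebra.lift ℂ (genM q ζ ξ) a = FreeAlgebra.lift ℂ (genM q ζ ξ) b := by
  have he := isSerreFamily_extendNodes_E (q := q) n
  apply Subtype.ext
  cases h <;> simp only [X, map_mul, map_smul, map_add, FreeAlgebra.lift_ι_apply,
    MulMemClass.coe_mul, AddMemClass.coe_add, Subalgebra.coe_smul, genM]
  case row i j k h =>
    have hrow := he.qCommute_grid_row hq (sq_add_one_ne_zero hq4 h) i h
    exact qCommute_Zt ζ ξ hq (by rwa [zpow_one, Z_eq_grid, Z_eq_grid])
  case col i j k h =>
    have hcol := he.qCommute_grid_col hq (sq_add_one_ne_zero hq4 h) j h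
    exact qCommute_Zt ζ ξ hq (by rwa [zpow_one, Z_eq_grid, Z_eq_grid])
  case anti i j s t h h' =>
    have hanti := he.commute_grid_anti hq (sq_add_one_ne_zero hq4 h) h h'
    have hZt := qCommute_Zt ζ ξ hq (i := i) (j := j) (s := s) (t := t) (m := 0) (by
      rw [zpow_zero, Z_eq_grid, Z_eq_grid]
      exact .of_commute hanti)
    rwa [add_zero] at hZt
  case diag i j s t h h' => exact Zt_mul_Zt_diag ζ ξ hq (sq_add_one_ne_zero hq4 h) h h'

end Relations

section Straightening

theorem finProdFinEquiv_lt_iff {n : ℕ} {i j s t : Fin n} :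
    ((finProdFinEquiv (i, j) : Fin (n * n)) : ℕ) < (finProdFinEquiv (s, t) : Fin (n * n)) ↔
      i < s ∨ i = s ∧ j < t := by
  simp only [finProdFinEquiv_apply_val, Fin.lt_def, Fin.ext_iff]
  rcases lt_trichotomy (i : ℕ) s with h | h | h
  · have hmul := Nat.mul_le_mul_left n (Nat.succ_le_of_lt h)
    rw [Nat.mul_succ] at hmul
    omega
  · rw [h]
    omega
  · have hmul := Nat.mul_le_mul_left n (Nat.succ_le_of_lt h)
    rw [Nat.mul_succ] at hmul
    omega

section

variable {K A : Type*} [Field K] [Ring A] [Algebra K A] {n : ℕ}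

theorem mem_initialSpan_lexVar (f : Fin n × Fin n → A) {i j s t : Fin n}
    (h : i < s ∨ i = s ∧ j < t) :
    f (i, j) ∈ initialSpan K (lexVar f) (finProdFinEquiv (s, t) : Fin (n * n)) := by
  rw [← lexVar_finProdFinEquiv f]
  exact mem_initialSpan (finProdFinEquiv_lt_iff.2 h)

theorem straightens_lexVar_of_lex {f : Fin n × Fin n → A}
    (hf : ∀ i j s t : Fin n, i < s ∨ i = s ∧ j < t → ∃ c : K, c ≠ 0 ∧
      f (s, t) * f (i, j) - c • (f (i, j) * f (s, t)) ∈
        initialSpan K (lexVar f) (finProdFinEquiv (s, t) : Fin (n * n)) ^ 2) :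
    Straightens K (lexVar f) (n * n) := by
  intro k hk l hl
  lift k to Fin (n * n) using hk
  lift l to Fin (n * n) using hl.trans k.2
  obtain ⟨⟨s, t⟩, rfl⟩ := finProdFinEquiv.surjective k
  obtain ⟨⟨i, j⟩, rfl⟩ := finProdFinEquiv.surjective l
  rw [lexVar_finProdFinEquiv, lexVar_finProdFinEquiv]
  exact hf i j s t (finProdFinEquiv_lt_iff.1 hl)

theorem exists_sub_smul_mul_mem {a b z : A} {c : K} (hc : c ≠ 0) (h : a * b = c • (b * a) + z)
    {S : Submodule K A} (hz : z ∈ S) : ∃ c' : K, c' ≠ 0 ∧ b * a - c' • (a * b) ∈ S := by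
  refine ⟨c⁻¹, inv_ne_zero hc, ?_⟩
  rw [h, smul_add, inv_smul_smul₀ hc, sub_add_cancel_left]
  exact neg_mem (S.smul_mem _ hz)

theorem QCommute.exists_sub_smul_mul_mem {a b : A} {c : K} (hc : c ≠ 0) (h : QCommute c a b)
    (S : Submodule K A) : ∃ c' : K, c' ≠ 0 ∧ b * a - c' • (a * b) ∈ S :=
  QuantumMatrix.exists_sub_smul_mul_mem hc (h.trans (add_zero _).symm) S.zero_mem

end

variable {A : Type*} [Ring A] [Algebra ℂ A] {n : ℕ} {q : ℂ}
  (ζ ξ : Fin n → WeightLattice (2 * n - 1))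

theorem straightens_lexVar_of_modRel (hq : q ≠ 0) {f : Fin n × Fin n → A}
    (hf : ∀ {a b}, ModRel q ζ ξ a b → FreeAlgebra.lift ℂ f a = FreeAlgebra.lift ℂ f b) :
    Straightens ℂ (lexVar f) (n * n) := by
  have hzpow (m : ℤ) : q ^ m ≠ 0 := zpow_ne_zero m hq
  refine straightens_lexVar_of_lex fun i j s t hlt => ?_
  rcases hlt with his | ⟨rfl, hjt⟩
  · rcases lt_trichotomy j t with hjt | rfl | htj
    · have hdiag := hf (ModRel.diag i j s t his hjt)
      simp only [X, map_mul, map_add, map_smul, FreeAlgebra.lift_ι_apply] at hdiag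
      refine exists_sub_smul_mul_mem (hzpow _) hdiag (Submodule.smul_mem _ _ ?_)
      rw [sq]
      exact Submodule.mul_mem_mul (mem_initialSpan_lexVar f (.inl his))
        (mem_initialSpan_lexVar f (.inr ⟨rfl, hjt⟩))
    · have hcol := hf (ModRel.col i j s his)
      simp only [X, map_mul, map_smul, FreeAlgebra.lift_ι_apply] at hcol
      exact QCommute.exists_sub_smul_mul_mem (hzpow _) hcol _
    · have hanti := hf (ModRel.anti i j s t his htj)
      simp only [X, map_mul, map_smul, FreeAlgebra.lift_ι_apply] at hanti
      exact QCommute.exists_sub_smul_mul_mem (hzpow _) hanti _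
  · have hrow := hf (ModRel.row i j t hjt)
    simp only [X, map_mul, map_smul, FreeAlgebra.lift_ι_apply] at hrow
    exact QCommute.exists_sub_smul_mul_mem (hzpow _) hrow _

end Straightening

section Presentation

variable {n : ℕ} {q : ℂ} (ζ ξ : Fin n → WeightLattice (2 * n - 1))

theorem adjoin_range_genM : Algebra.adjoin ℂ (Set.range (genM q ζ ξ)) = ⊤ := by
  have hpreimage : Set.range (genM q ζ ξ) =
      ((↑) : modifiedAlgebra q ζ ξ → Uq (2 * n - 1) q) ⁻¹'
        Set.range fun p : Fin n × Fin n => Zt q ζ ξ p.1 p.2 := by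
    ext x
    simp only [Set.mem_range, Set.mem_preimage, genM, Subtype.ext_iff]
  rw [hpreimage]
  exact Algebra.adjoin_adjoin_coe_preimage

theorem gradedPart_eq_initialSpan_pow (d : ℕ) :
    gradedPart q ζ ξ d = initialSpan ℂ (lexVar (genM q ζ ξ)) (n * n) ^ d := by
  rw [gradedPart, initialSpan, image_lexVar]

theorem linearIndependent_orderedMonomial_genM (hq : q ≠ 0) (hq2 : q ^ 2 ≠ 1) :
    LinearIndependent ℂ (orderedMonomial (lexVar (genM q ζ ξ)) (n * n)) := by
  have htwist (a : Fin (n * n) → ℕ) : IsTwist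
      (orderedMonomial (lexVar fun p : Fin n × Fin n => Z q p.1 p.2) (n * n) a)
      (orderedMonomial (lexVar (genM q ζ ξ)) (n * n) a).val := by
    have hval := map_orderedMonomial_lexVar (modifiedAlgebra q ζ ξ).val (genM q ζ ξ) a
    refine Eq.subst (motive := IsTwist _) hval.symm (.orderedMonomial hq (fun l hl => ?_) a)
    rw [lexVar_of_lt _ hl, lexVar_of_lt _ hl]
    exact isTwist_Zt ζ ξ hq _ _
  choose γ _ c hc θ hθ using htwist
  let φ := feiginEval n hq ∘ₗ (modifiedAlgebra q ζ ξ).val.toLinearMap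
  have hφ (a : Fin (n * n) → ℕ) : φ (orderedMonomial (lexVar (genM q ζ ξ)) (n * n) a) =
      c a • orderedMonomial (lexVar fun p : Fin n × Fin n =>
        grid q (colourSum (torusVar n q) n) p.1 p.2) (n * n) a (Finsupp.single 0 1) := by
    rw [LinearMap.comp_apply, AlgHom.toLinearMap_apply, Subalgebra.val_apply, hθ a, map_smul,
      feiginEval_mul_L, feiginEval_orderedMonomial]
  refine .of_comp φ ?_
  rw [Function.comp_def, funext hφ]
  exact (linearIndependent_orderedMonomial_grid hq hq2).units_smul fun a => Units.mk0 (c a) (hc a)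

theorem isPBWSequence_genM (hq : q ≠ 0) (hq2 : q ^ 2 ≠ 1) (hq4 : 2 ≤ n → q ^ 4 ≠ 1) :
    IsPBWSequence ℂ (lexVar (genM q ζ ξ)) (n * n) where
  straightens := straightens_lexVar_of_modRel ζ ξ hq (lift_genM_eq_of_modRel ζ ξ hq hq4)
  linearIndependent := linearIndependent_orderedMonomial_genM ζ ξ hq hq2

theorem initialAdjoin_lexVar_genM :
    initialAdjoin ℂ (lexVar (genM q ζ ξ)) (n * n) = ⊤ := by
  rw [initialAdjoin, image_lexVar, adjoin_range_genM]

variable (q) in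
/-- The image of the free generator `X_{i,j}` in the algebra presented by the quadratic
relations. -/
def genQuot (p : Fin n × Fin n) : RingQuot (ModRel q ζ ξ) :=
  RingQuot.mkAlgHom ℂ (ModRel q ζ ξ) (X p.1 p.2)

theorem lift_genQuot :
    FreeAlgebra.lift ℂ (genQuot q ζ ξ) = RingQuot.mkAlgHom ℂ (ModRel q ζ ξ) := by
  ext p
  simp only [Function.comp_apply, FreeAlgebra.lift_ι_apply, genQuot, X]

theorem straightens_lexVar_genQuot (hq : q ≠ 0) :
    Straightens ℂ (lexVar (genQuot q ζ ξ)) (n * n) :=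
  straightens_lexVar_of_modRel ζ ξ hq fun h => by
    rw [lift_genQuot, RingQuot.mkAlgHom_rel ℂ h]

theorem initialAdjoin_lexVar_genQuot :
    initialAdjoin ℂ (lexVar (genQuot q ζ ξ)) (n * n) = ⊤ := by
  rw [initialAdjoin, image_lexVar, Algebra.adjoin_range_eq_range_freeAlgebra_lift,
    lift_genQuot, AlgHom.range_eq_top]
  exact RingQuot.mkAlgHom_surjective ℂ _

theorem exists_algEquiv_genQuot_eq_genM (hq : q ≠ 0) (hq2 : q ^ 2 ≠ 1)
    (hq4 : 2 ≤ n → q ^ 4 ≠ 1) :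
    ∃ e : RingQuot (ModRel q ζ ξ) ≃ₐ[ℂ] modifiedAlgebra q ζ ξ,
      ∀ p, e (genQuot q ζ ξ p) = genM q ζ ξ p := by
  let f : RingQuot (ModRel q ζ ξ) →ₐ[ℂ] modifiedAlgebra q ζ ξ :=
    RingQuot.liftAlgHom ℂ ⟨FreeAlgebra.lift ℂ (genM q ζ ξ),
      fun {_ _} => lift_genM_eq_of_modRel ζ ξ hq hq4⟩
  have hf (p) : f (genQuot q ζ ξ p) = genM q ζ ξ p := by
    simp only [f, genQuot, X, RingQuot.liftAlgHom_mkAlgHom_apply, FreeAlgebra.lift_ι_apply]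
  have hlex : f ∘ lexVar (genQuot q ζ ξ) = lexVar (genM q ζ ξ) := by
    rw [← funext hf]
    exact map_comp_lexVar f _
  have hinj : Function.Injective f :=
    injective_of_straightens (K := ℂ) (A := modifiedAlgebra q ζ ξ) (B := RingQuot (ModRel q ζ ξ))
      (straightens_lexVar_genQuot ζ ξ hq) (initialAdjoin_lexVar_genQuot ζ ξ) f
      (by rw [hlex]; exact linearIndependent_orderedMonomial_genM ζ ξ hq hq2)
  have hsurj : Function.Surjective f := by
    rw [← AlgHom.range_eq_top, eq_top_iff, ← adjoin_range_genM, Algebra.adjoin_le_iff]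
    rintro _ ⟨p, rfl⟩
    exact ⟨_, hf p⟩
  exact ⟨.ofBijective f ⟨hinj, hsurj⟩, hf⟩

end Presentation

end QuantumMatrix

theorem mainTheorem1 (n : ℕ) (hn : 1 ≤ n) (q : ℂ) (hq0 : q ≠ 0) (hq2 : q ^ 2 ≠ 1)
    (hq4 : 2 ≤ n → q ^ 4 ≠ 1)
    (ζ ξ : Fin n → QuantumMatrix.WeightLattice (2 * n - 1)) :
    -- iterated Ore extension of `ℂ` in the variables `Z̃_{i,j}`, in lexicographic order
    QuantumMatrix.IsIteratedOreExtension ℂ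
      (fun k : Fin (n * n) => QuantumMatrix.genM q ζ ξ (finProdFinEquiv.symm k)) ∧
    -- a domain
    IsDomain (QuantumMatrix.modifiedAlgebra q ζ ξ) ∧
    -- graded by the degree in the generators, with the Hilbert series of a polynomial ring
    DirectSum.IsInternal (QuantumMatrix.gradedPart q ζ ξ) ∧
    QuantumMatrix.hilbertSeries (QuantumMatrix.gradedPart q ζ ξ) =
      QuantumMatrix.hilbertSeries (MvPolynomial.homogeneousSubmodule (Fin n × Fin n) ℂ) ∧
    -- presented by the quadratic relations
    ∃ e : RingQuot (QuantumMatrix.ModRel q ζ ξ) ≃ₐ[ℂ] QuantumMatrix.modifiedAlgebra q ζ ξ,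
      ∀ i j : Fin n,
        e (RingQuot.mkAlgHom ℂ (QuantumMatrix.ModRel q ζ ξ) (QuantumMatrix.X i j)) =
          QuantumMatrix.genM q ζ ξ (i, j) := by
  open QuantumMatrix in
  have hpbw := isPBWSequence_genM ζ ξ hq0 hq2 hq4
  have hgen := initialAdjoin_lexVar_genM (q := q) ζ ξ
  rw [funext (gradedPart_eq_initialSpan_pow ζ ξ)]
  refine ⟨?_, hpbw.isDomain hgen, hpbw.isInternal_initialSpan_pow hgen,
    hpbw.hilbertSeries_initialSpan_pow finProdFinEquiv, ?_⟩
  · simpa only [lexVar_coe] using hpbw.isIteratedOreExtension hgen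
  · obtain ⟨e, he⟩ := exists_algEquiv_genQuot_eq_genM ζ ξ hq0 hq2 hq4
    exact ⟨e, fun i j => he (i, j)⟩
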